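/- Let $K$ be a field of characteristic zero with algebraic closure $\bar K$, and let $L/K$ be an abelian extension (a possibly infinite Galois extension with abelian Galois group) with $K\subseteq L\subseteq \bar K$. An abelian variety over $K$ is a proper geometrically integral group scheme over $K$; it is simple if it is nonzero and has no abelian subvarieties over $K$ other than $0$ and itself; an isogeny is a surjective homomorphism of group schemes over $K$ with finite kernel; and the rank of an abelian group $\Gamma$ is $\mathrm{rk}(\Gamma)=\dim_{\mathbb{Q}}(\Gamma\otimes_{\mathbb{Z}}\mathbb{Q})$. Let $A$ be an abelian variety over $K$, and let $\alpha\colon \prod_{i=1}^k A_i\to A$ be an isogeny, where each $A_i$ is a simple abelian variety over $K$ such that $$\mathrm{rk}\bigl(A_i(L)/A_i(K_1)\bigr)=\infty$$ for every finite subextension $K_1/K$ of $L/K$. Then for every finite set $S\subseteq A(\bar K)$ and all proper abelian subvarieties $B_1,\dots,B_r\subsetneq A$ over $K$ there exist $t\in A(L)$ and $\sigma\in\mathrm{Gal}(L/K)$ such that $$t-\sigma(t)\notin S+\bigcup_{j=1}^r B_j(\bar K).$$ -/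

import Mathlib

universe u

open CategoryTheory CategoryTheory.Limits AlgebraicGeometry

namespace AbVar

open MonoidalCategory CartesianMonoidalCategory MonObj
open scoped TensorProduct

/-- The rational rank `dim_ℚ (Γ ⊗_ℤ ℚ)` of an abelian group `Γ`, as a cardinal number. -/
noncomputable def rationalRank (Γ : Type u) [AddCommGroup Γ] : Cardinal.{u} :=
  Module.rank ℚ (ℚ ⊗[ℤ] Γ)

/-- Group schemes over the field `K`. -/
noncomputable abbrev GroupScheme (K : Type u) [Field K] : Type (u + 1) :=
  Grp (Over (Spec (.of K)))

/-- The morphism of schemes underlying a homomorphism of group schemes. -/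
noncomputable abbrev GroupScheme.homLeft {K : Type u} [Field K] {G H : GroupScheme K} (f : G ⟶ H) :
    G.X.left ⟶ H.X.left :=
  f.hom.hom.left

/-- The kernel of a homomorphism `f : G ⟶ H` of group schemes over `K`, as a `K`-scheme:
the fibre product of `f` with the unit section `Spec K ⟶ H`. -/
noncomputable def GroupScheme.kerToBase {K : Type u} [Field K] {G H : GroupScheme K} (f : G ⟶ H) :
    pullback (GroupScheme.homLeft f) η[H.X].left ⟶ Spec (.of K) :=
  pullback.snd (GroupScheme.homLeft f) η[H.X].left

/-- An isogeny: a surjective homomorphism with finite kernel. -/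
structure IsIsogeny {K : Type u} [Field K] {G H : GroupScheme K} (f : G ⟶ H) : Prop where
  surjective : Surjective (GroupScheme.homLeft f)
  finite_ker : IsFinite (GroupScheme.kerToBase f)

/-- An abelian variety over `K`: a proper geometrically integral group scheme over `K`. -/
structure AbelianVariety (K : Type u) [Field K] where
  toGroupScheme : GroupScheme K
  isProper : IsProper toGroupScheme.X.hom
  geometricallyIntegral : GeometricallyIntegral toGroupScheme.X.hom

namespace AbelianVariety

variable {K : Type u} [Field K]

instance (A : AbelianVariety K) : IsCommMonObj A.toGroupScheme.X :=
  haveI := A.isProper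
  haveI := A.geometricallyIntegral
  isCommMonObj_of_isProper_of_geometricallyIntegral A.toGroupScheme.X

/-- `A` is the zero abelian variety, i.e. its structure morphism to `Spec K` is an isomorphism. -/
def IsTrivial (A : AbelianVariety K) : Prop :=
  IsIso A.toGroupScheme.X.hom

/-- An abelian subvariety of `A`: an abelian variety together with a homomorphism to `A` that is
a closed immersion. -/
structure Subvariety (A : AbelianVariety K) where
  toAbelianVariety : AbelianVariety K
  incl : toAbelianVariety.toGroupScheme ⟶ A.toGroupScheme
  isClosedImmersion : IsClosedImmersion (GroupScheme.homLeft incl)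

/-- The abelian subvariety `B` of `A` is not all of `A`. -/
def Subvariety.IsProperSub {A : AbelianVariety K} (B : A.Subvariety) : Prop :=
  ¬ IsIso (GroupScheme.homLeft B.incl)

/-- A simple abelian variety over `K`: it is nonzero, and its only abelian subvarieties over `K`
are zero and itself. -/
structure IsSimple (A : AbelianVariety K) : Prop where
  not_isTrivial : ¬ A.IsTrivial
  eq_zero_or_eq_self : ∀ B : A.Subvariety, B.IsProperSub → B.toAbelianVariety.IsTrivial

/-- `Spec L` as a scheme over `K`, for a field extension `L/K`. -/
noncomputable abbrev specOver (K : Type u) [Field K] (L : Type u) [Field L] [Algebra K L] :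
    Over (Spec (.of K)) :=
  Over.mk (Spec.map (CommRingCat.ofHom (algebraMap K L)))

/-- The morphism `Spec M ⟶ Spec L` over `K` given by a `K`-embedding `L → M`. -/
noncomputable abbrev specOverMap {L M : Type u} [Field L] [Field M] [Algebra K L] [Algebra K M]
    (φ : L →ₐ[K] M) : specOver K M ⟶ specOver K L :=
  Over.homMk (Spec.map (CommRingCat.ofHom φ.toRingHom)) (by
    simp only [Over.mk_left, Over.mk_hom, ← Spec.map_comp, ← CommRingCat.ofHom_comp]
    congr 2
    exact φ.comp_algebraMap)

/-- The set `A(L)` of `L`-rational points of `A`, i.e. of `K`-morphisms `Spec L ⟶ A`. -/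
def Points (A : AbelianVariety K) (L : Type u) [Field L] [Algebra K L] : Type u :=
  Additive (specOver K L ⟶ A.toGroupScheme.X)

/-- The group law of `A` makes `A(L)` an abelian group, written additively. -/
noncomputable instance (A : AbelianVariety K) (L : Type u) [Field L] [Algebra K L] :
    AddCommGroup (A.Points L) :=
  inferInstanceAs (AddCommGroup (Additive (specOver K L ⟶ A.toGroupScheme.X)))

/-- The point of `A(L)` given by a `K`-morphism `Spec L ⟶ A`. -/
def Points.ofHom {A : AbelianVariety K} {L : Type u} [Field L] [Algebra K L]
    (x : specOver K L ⟶ A.toGroupScheme.X) : A.Points L :=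
  Additive.ofMul x

/-- The `K`-morphism `Spec L ⟶ A` given by a point of `A(L)`. -/
def Points.toHom {A : AbelianVariety K} {L : Type u} [Field L] [Algebra K L]
    (x : A.Points L) : specOver K L ⟶ A.toGroupScheme.X :=
  Additive.toMul x

/-- The homomorphism `A(L) → A(M)` induced by a `K`-embedding `φ : L → M`. For `M = L` and
`φ = σ` an automorphism of `L/K` it is the Galois action `t ↦ σ(t)` on `A(L)`. -/
noncomputable def Points.map (A : AbelianVariety K) {L M : Type u} [Field L] [Field M]
    [Algebra K L] [Algebra K M] (φ : L →ₐ[K] M) : A.Points L →+ A.Points M where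
  toFun x := .ofHom (specOverMap φ ≫ x.toHom)
  map_zero' := congrArg Points.ofHom (MonObj.comp_one (specOverMap φ))
  map_add' x y := congrArg Points.ofHom (MonObj.comp_mul (specOverMap φ) x.toHom y.toHom)

/-- The set of points `B(L) ⊆ A(L)` of an abelian subvariety `B` of `A`. -/
def Subvariety.points {A : AbelianVariety K} (B : A.Subvariety) (L : Type u) [Field L]
    [Algebra K L] : Set (A.Points L) :=
  Set.range fun y : B.toAbelianVariety.Points L => Points.ofHom (y.toHom ≫ B.incl.hom.hom)

end AbelianVariety

end AbVar

open scoped Pointwise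

/-! Suppose every `t - σ t` lies in `S + ⋃ B_j`. For a fixed `σ`, finitely many cosets of the groups
`B_j(Kbar)` then cover the image of `1 - σ` on `A(L)`. By B. H. Neumann's covering lemma some `j`
and some `n > 0` satisfy `n (1 - σ) A(L) ⊆ B_j`. For each `j` the `σ` with this property form a
subgroup of the Galois group. These finitely many subgroups cover the whole group, so by Neumann's
lemma again one of them, `G`, has finite index (`exists_finiteIndex_displacementSubgroup`).

Since `α` is surjective, some simple factor `A_i` is not mapped into this `B_j`
(`exists_comap_ne_univ`). The preimage of `B_j` in `A_i` is a proper closed subgroup, and simplicity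
leaves it only finitely many geometric points (`AbelianVariety.IsSimple.finite_points_of_ne_univ`).
Hence `t - σ t` is torsion for all `t ∈ A_i(L)` and `σ ∈ G`. Orbits of points are finite, so one
multiple of `t` is fixed by `G` and descends to the fixed field `K₁` of `G`, which is finite over
`K`. Thus `A_i(L)/A_i(K₁)` is torsion and has rank zero, a contradiction.

Most of the work lies in the finiteness statement: the reduced identity component of a closed
subgroup must be shown to be an abelian subvariety. Homogeneity under translations over `Kbar` makes
it geometrically irreducible, and characteristic zero makes it geometrically reduced. -/

namespace AbVar

open scoped TensorProduct

/-! ### Tensor products over a field: domains and reducedness. -/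

/-- Over an algebraically closed field, elements of a finitely generated algebra that are killed by
every rational point are nilpotent. -/
lemma isNilpotent_of_forall_algHom {k A : Type*} [Field k] [IsAlgClosed k] [CommRing A]
    [Algebra k A] [Algebra.FiniteType k A] (a : A) (h : ∀ φ : A →ₐ[k] k, φ a = 0) :
    IsNilpotent a := by
  have : IsJacobsonRing A := isJacobsonRing_of_finiteType (A := k)
  rw [← mem_nilradical, nilradical, ← IsJacobsonRing.out ‹_› (Ideal.radical_isRadical _),
    Ideal.jacobson, Submodule.mem_sInf]
  rintro m ⟨-, hm⟩
  let := Ideal.Quotient.field m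
  have : Module.Finite k (A ⧸ m) := finite_of_finite_type_of_isJacobsonRing k (A ⧸ m)
  let e : k ≃ₐ[k] A ⧸ m := AlgEquiv.ofBijective (Algebra.ofId k (A ⧸ m))
    IsAlgClosed.algebraMap_bijective_of_isIntegral
  have := h (e.symm.toAlgHom.comp (Ideal.Quotient.mkₐ k m))
  simpa [Ideal.Quotient.eq_zero_iff_mem] using this

/-- The tensor product of a domain and a finitely generated domain over an algebraically closed
field has no zero divisors. -/
lemma noZeroDivisors_tensorProduct_of_finiteType {k A B : Type*} [Field k] [IsAlgClosed k]
    [CommRing A] [Algebra k A] [Algebra.FiniteType k A] [IsDomain A]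
    [CommRing B] [Algebra k B] [IsDomain B] : NoZeroDivisors (A ⊗[k] B) := by
  -- A `k`-basis of `B` is an `A`-basis of `A ⊗ B`, and `Φ φ` evaluates the coordinates at the
  -- rational point `φ`.
  let b := Module.Basis.ofVectorSpace k B
  let c := Algebra.TensorProduct.basis A b
  let Φ (φ : A →ₐ[k] k) : A ⊗[k] B →ₐ[k] B :=
    Algebra.TensorProduct.lift ((Algebra.ofId k B).comp φ) (AlgHom.id k B) fun _ _ ↦ .all _ _
  have hΦ (φ : A →ₐ[k] k) (x : A ⊗[k] B) (i) : b.repr (Φ φ x) i = φ (c.repr x i) := by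
    induction x with
    | zero => simp
    | add x y hx hy => simp [hx, hy]
    | tmul a y => 
      have : Φ φ (a ⊗ₜ y) = φ a • y := by simp [Φ, Algebra.ofId_apply, Algebra.smul_def]
      simp [this, c]
  refine ⟨fun {x y} hxy ↦ ?_⟩
  -- At each rational point one specialised factor vanishes because `B` is a domain. Products of
  -- coordinates thus vanish at all rational points, and the Nullstellensatz applies.
  have key (i j) : c.repr x i * c.repr y j = 0 := by
    refine (isNilpotent_of_forall_algHom (k := k) _ fun φ ↦ ?_).eq_zero
    have : Φ φ x * Φ φ y = 0 := by rw [← map_mul, hxy, map_zero]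
    rw [map_mul, ← hΦ, ← hΦ]
    rcases mul_eq_zero.mp this with h | h <;> simp [h]
  by_contra! H
  obtain ⟨i, hi⟩ := DFunLike.ne_iff.mp (c.repr.map_ne_zero_iff.mpr H.1)
  obtain ⟨j, hj⟩ := DFunLike.ne_iff.mp (c.repr.map_ne_zero_iff.mpr H.2)
  exact (mul_ne_zero hi hj) (key i j)

/-- The tensor product of two domains over an algebraically closed field is a domain. -/
lemma isDomain_tensorProduct_of_isAlgClosed (k A B : Type*) [Field k] [IsAlgClosed k]
    [CommRing A] [Algebra k A] [IsDomain A]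
    [CommRing B] [Algebra k B] [IsDomain B] : IsDomain (B ⊗[k] A) := by
  have : NoZeroDivisors (B ⊗[k] A) := by
    refine ⟨fun {x y} hxy ↦ ?_⟩
    obtain ⟨C, hC, hxC⟩ := exists_fg_and_mem_baseChange x
    obtain ⟨D, hD, hyD⟩ := exists_fg_and_mem_baseChange y
    have hCD : (C ⊔ D).FG := hC.sup hD
    have : Algebra.FiniteType k ↥(C ⊔ D) := (Subalgebra.fg_iff_finiteType _).mp hCD
    have baseChange_mono {S : Subalgebra k A} (h : S ≤ C ⊔ D) :
        S.baseChange B ≤ (C ⊔ D).baseChange B := by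
      rintro - ⟨z, rfl⟩
      refine ⟨Algebra.TensorProduct.map (AlgHom.id B B) (Subalgebra.inclusion h) z, ?_⟩
      induction z with
      | zero => simp
      | add x y hx hy => simp only [map_add] at hx hy ⊢; rw [hx, hy]
      | tmul b a => rfl
    let f := Algebra.TensorProduct.map (AlgHom.id B B) (C ⊔ D).val
    have hf : Function.Injective f :=
      Module.Flat.lTensor_preserves_injective_linearMap _ Subtype.val_injective
    obtain ⟨x, rfl⟩ : x ∈ f.range := baseChange_mono le_sup_left hxC
    obtain ⟨y, rfl⟩ : y ∈ f.range := baseChange_mono le_sup_right hyD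
    have : NoZeroDivisors (B ⊗[k] ↥(C ⊔ D)) :=
      have := noZeroDivisors_tensorProduct_of_finiteType (k := k) (A := ↥(C ⊔ D)) (B := B)
      (Algebra.TensorProduct.comm k B ↥(C ⊔ D)).injective.noZeroDivisors _ (map_zero _)
        (map_mul _)
    change f x * f y = 0 at hxy
    rw [← map_mul, map_eq_zero_iff f hf, mul_eq_zero] at hxy
    exact hxy.imp (fun h ↦ by rw [h]; exact map_zero f) (fun h ↦ by rw [h]; exact map_zero f)
  exact NoZeroDivisors.to_isDomain _

/-- The tensor product of a field extension with a separable algebraic one is reduced. -/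
lemma isReduced_tensorProduct_of_isSeparable (k E F : Type*) [Field k] [Field E] [Field F]
    [Algebra k E] [Algebra k F] [Algebra.IsSeparable k F] : IsReduced (E ⊗[k] F) := by
  refine IsReduced.tensorProduct_of_flat_of_forall_fg fun B hB ↦ ?_
  have : Algebra.FiniteType k B := (Subalgebra.fg_iff_finiteType _).mp hB
  have : Algebra.IsIntegral k B := ⟨fun x ↦
    (isIntegral_algHom_iff B.val Subtype.val_injective).mp (Algebra.IsIntegral.isIntegral _)⟩
  let : Field B := (Algebra.IsIntegral.isField_iff_isField (R := k) (S := B)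
    (algebraMap k B).injective |>.mp (Field.toIsField k)).toField
  have : Algebra.IsSeparable k B := Algebra.IsSeparable.of_algHom k F B.val
  have : Module.Finite k B := Algebra.IsIntegral.finite
  have : Algebra.FormallyUnramified k B := Algebra.FormallyUnramified.of_isSeparable k B
  exact Algebra.FormallyUnramified.isReduced_of_field E (E ⊗[k] B)

/-! ### Topology: connected preimages and homogeneous Noetherian spaces. -/

/-- The preimage of a preconnected set under an open and closed map is preconnected if some fibre
has at most one point. -/
lemma isPreconnected_preimage_of_subsingleton_fiber {X Y : Type*} [TopologicalSpace X]
    [TopologicalSpace Y] {f : X → Y} (hfo : IsOpenMap f) (hfc : IsClosedMap f)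
    {D : Set Y} (hD : IsPreconnected D) {y : Y} (hy : y ∈ D) (hfib : (f ⁻¹' {y}).Subsingleton) :
    IsPreconnected (f ⁻¹' D) := by
  rw [isPreconnected_iff_preconnectedSpace] at hD ⊢
  let g : f ⁻¹' D → D := D.restrictPreimage f
  have hgo : IsOpenMap g := hfo.restrictPreimage D
  have hgc : IsClosedMap g := hfc.restrictPreimage D
  rw [preconnectedSpace_iff_clopen]
  intro s hs
  by_contra! H
  -- A nonempty clopen piece surjects onto `D`; two complementary pieces would both meet the
  -- one-point fibre.
  have key (t : Set (f ⁻¹' D)) (ht : IsClopen t) (hne : t.Nonempty) : ∃ x ∈ t, f x = y := by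
    have : g '' t = Set.univ :=
      IsClopen.eq_univ ⟨hgc _ ht.1, hgo _ ht.2⟩ (hne.image g)
    obtain ⟨x, hx, e⟩ := this.ge (Set.mem_univ ⟨y, hy⟩)
    exact ⟨x, hx, congr_arg Subtype.val e⟩
  obtain ⟨a, ha, ha'⟩ := key s hs H.1
  obtain ⟨b, hb, hb'⟩ := key sᶜ hs.compl (Set.nonempty_compl.mpr H.2)
  exact hb ((Subtype.ext (hfib ha' hb') : a = b) ▸ ha)

section Homogeneous

variable {X : Type*} [TopologicalSpace X] [TopologicalSpace.NoetherianSpace X] {S : Set X}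

/-- A Noetherian space is locally irreducible if its homeomorphisms act transitively on a very dense
subset. -/
lemma exists_isPreirreducible_nhd_of_homogeneous
    (hS : ∀ Z : Set X, IsLocallyClosed Z → Z.Nonempty → (Z ∩ S).Nonempty)
    (htrans : ∀ x ∈ S, ∀ y ∈ S, ∃ h : X ≃ₜ X, h x = y) (x : X) :
    ∃ U : Set X, IsOpen U ∧ x ∈ U ∧ IsPreirreducible U := by
  obtain ⟨s, hs, hsS⟩ := hS (closure {x}) isClosed_closure.isLocallyClosed ⟨x, subset_closure rfl⟩
  have hfin := TopologicalSpace.NoetherianSpace.finite_irreducibleComponents (α := X)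
  have hcl := closure_sUnion_irreducibleComponents_sdiff_singleton hfin (irreducibleComponent x)
    (irreducibleComponent_mem_irreducibleComponents x)
  set U := (⋃₀ (irreducibleComponents X \ {irreducibleComponent x}))ᶜ
  have hU : IsOpen U := by
    rw [isOpen_compl_iff, Set.sUnion_eq_biUnion]
    exact hfin.sdiff.isClosed_biUnion fun W hW ↦ isClosed_of_mem_irreducibleComponents W hW.1
  have hUZ : U ⊆ irreducibleComponent x := subset_closure.trans hcl.le
  have hne : U.Nonempty := by
    rw [← closure_nonempty_iff, hcl]
    exact ⟨x, mem_irreducibleComponent⟩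
  obtain ⟨t, ht, htS⟩ := hS U hU.isLocallyClosed hne
  -- The open set `U` meets only one component. Moving it to contain the specialisation `s` of `x`
  -- makes it contain `x` as well.
  obtain ⟨h, hh⟩ := htrans t htS s hsS
  have hs' : s ∈ h '' U := ⟨t, ht, hh⟩
  have ho : IsOpen (h '' U) := h.isOpenMap _ hU
  refine ⟨h '' U, ho, (specializes_iff_mem_closure.mpr hs).mem_open ho hs', ?_⟩
  refine IsPreirreducible.image ?_ h h.continuous.continuousOn
  exact isIrreducible_irreducibleComponent.isPreirreducible.open_subset hU hUZ

/-- Local irreducibility makes irreducible components open; being also closed and connected, they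
are the connected components. -/
lemma isIrreducible_connectedComponent_of_homogeneous
    (hS : ∀ Z : Set X, IsLocallyClosed Z → Z.Nonempty → (Z ∩ S).Nonempty)
    (htrans : ∀ x ∈ S, ∀ y ∈ S, ∃ h : X ≃ₜ X, h x = y) (x : X) :
    IsIrreducible (connectedComponent x) := by
  have hZ := isIrreducible_irreducibleComponent (x := x)
  have hopen : IsOpen (irreducibleComponent x) := by
    rw [isOpen_iff_forall_mem_open]
    intro z hz
    obtain ⟨U, hU, hzU, hUi⟩ := exists_isPreirreducible_nhd_of_homogeneous hS htrans z
    refine ⟨U, ?_, hU, hzU⟩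
    have h1 : irreducibleComponent x ⊆ closure U :=
      (subset_closure_inter_of_isPreirreducible_of_isOpen hZ.isPreirreducible hU ⟨z, hz, hzU⟩).trans
        (closure_mono Set.inter_subset_right)
    rw [← eq_irreducibleComponent hUi.closure h1]
    exact subset_closure
  have : connectedComponent x = irreducibleComponent x :=
    (IsClopen.connectedComponent_subset ⟨isClosed_irreducibleComponent, hopen⟩
      mem_irreducibleComponent).antisymm
      (hZ.isPreirreducible.isPreconnected.subset_connectedComponent mem_irreducibleComponent)
  rwa [this]

/-- If homeomorphisms of a Noetherian space act transitively on a subset and some point of this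
subset is a connected component, then the subset is finite. -/
lemma finite_of_connectedComponent_eq_singleton
    (htrans : ∀ x ∈ S, ∀ y ∈ S, ∃ h : X ≃ₜ X, h x = y) {x : X} (hx : x ∈ S)
    (h : connectedComponent x ⊆ {x}) : S.Finite := by
  have key (y) (hy : y ∈ S) : irreducibleComponent y = {y} := by
    obtain ⟨e, rfl⟩ := htrans x hx y hy
    refine Set.Subset.antisymm ?_ (by simpa using mem_irreducibleComponent)
    refine irreducibleComponent_subset_connectedComponent.trans fun z hz ↦ ?_
    have h1 := e.symm.continuous.image_connectedComponent_subset (e x) ⟨z, hz, rfl⟩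
    rw [e.symm_apply_apply] at h1
    have h2 : e.symm z = x := h h1
    simp [← h2]
  -- Each point of `S` is an entire irreducible component, and a Noetherian space has finitely many
  -- of these.
  refine Set.Finite.of_finite_image (f := irreducibleComponent) ?_ ?_
  · refine TopologicalSpace.NoetherianSpace.finite_irreducibleComponents (α := X).subset ?_
    rintro - ⟨y, -, rfl⟩
    exact irreducibleComponent_mem_irreducibleComponents y
  · intro y hy z hz e
    simpa [key y hy, key z hz] using e

end Homogeneous

/-! ### Geometric integrality and reducedness. -/

section Geometric

lemma isIntegral_of_iso {X Y : Scheme.{u}} (e : X ≅ Y) [IsIntegral Y] : IsIntegral X :=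
  have : Nonempty X := ⟨e.inv (Classical.arbitrary Y)⟩
  isIntegral_of_isOpenImmersion e.hom

instance : ObjectProperty.IsClosedUnderIsomorphisms IsIntegral where
  of_iso e _ := isIntegral_of_iso e.symm

variable {K : Type u} [Field K]

instance geometricallyIntegral_SpecMap_of_isAlgClosed [IsAlgClosed K] (F : Type u) [Field F]
    [Algebra K F] : GeometricallyIntegral (Spec.map (CommRingCat.ofHom (algebraMap K F))) := by
  rw [geometricallyIntegral_iff, geometrically_iff_of_commRing_of_isClosedUnderIsomorphisms]
  intro E _ _
  have := isDomain_tensorProduct_of_isAlgClosed K E F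
  have : IsIntegral (Spec (.of (F ⊗[K] E))) := inferInstance
  exact isIntegral_of_iso (pullbackSpecIso K F E)

instance geometricallyReduced_SpecMap_of_isSeparable (F : Type u) [Field F]
    [Algebra K F] [Algebra.IsSeparable K F] :
    GeometricallyReduced (Spec.map (CommRingCat.ofHom (algebraMap K F))) := by
  rw [geometricallyReduced_iff, geometrically_iff_of_commRing_of_isClosedUnderIsomorphisms]
  intro E _ _
  have := isReduced_tensorProduct_of_isSeparable K E F
  have : _root_.IsReduced (F ⊗[K] E) :=
    isReduced_of_injective _ (Algebra.TensorProduct.comm K F E).injective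
  have : IsReduced (Spec (.of (F ⊗[K] E))) := inferInstance
  exact isReduced_of_isOpenImmersion (pullbackSpecIso K F E).hom

/-- A scheme of finite type over a field is geometrically integral if its base change to an
algebraic closure is integral. -/
lemma geometricallyIntegral_of_isIntegral_pullback (Kbar : Type u) [Field Kbar] [Algebra K Kbar]
    [IsAlgClosure K Kbar] {X : Scheme.{u}} (f : X ⟶ Spec (.of K)) [LocallyOfFiniteType f]
    [IsIntegral (pullback f (Spec.map (CommRingCat.ofHom (algebraMap K Kbar))))] :
    GeometricallyIntegral f := by
  have : IsAlgClosed Kbar := IsAlgClosure.isAlgClosed K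
  have : Algebra.IsAlgebraic K Kbar := IsAlgClosure.isAlgebraic
  rw [geometricallyIntegral_iff, geometrically_iff_of_commRing_of_isClosedUnderIsomorphisms]
  intro E _ _
  -- Integrality ascends from `Kbar` to a field `Ω` containing both `Kbar` and `E`, then descends
  -- from `Ω` to `E`.
  let Ω := AlgebraicClosure E
  let φ : Kbar →ₐ[K] Ω := IsAlgClosed.lift
  algebraize [φ.toRingHom]
  let a := Spec.map (CommRingCat.ofHom (algebraMap K Kbar))
  let b := Spec.map (CommRingCat.ofHom (algebraMap Kbar Ω))
  let c := Spec.map (CommRingCat.ofHom (algebraMap K E))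
  let d := Spec.map (CommRingCat.ofHom (algebraMap E Ω))
  have hbd : d ≫ c = b ≫ a := by
    simp only [a, b, c, d, ← Spec.map_comp, ← CommRingCat.ofHom_comp]
    congr 2
    rw [← IsScalarTower.algebraMap_eq]
    exact φ.comp_algebraMap.symm
  have : IsLocallyNoetherian (pullback f a) :=
    LocallyOfFiniteType.isLocallyNoetherian (pullback.snd f a)
  have : IsIntegral (pullback (pullback.snd f a) b) := inferInstance
  have : IsIntegral (pullback f (b ≫ a)) :=
    isIntegral_of_iso (pullbackLeftPullbackSndIso f a b).symm
  rw [← hbd] at this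
  have : IsIntegral (pullback (pullback.snd f c) d) :=
    isIntegral_of_iso (pullbackLeftPullbackSndIso f c d)
  let p := pullback.fst (pullback.snd f c) d
  have : IsSchemeTheoreticallyDominant d := .of_isDominant d
  have : IsReduced (pullback f c) := IsSchemeTheoreticallyDominant.isReduced p
  have : IrreducibleSpace ↥(pullback f c) := by
    rw [irreducibleSpace_def, Set.top_eq_univ, ← Set.range_eq_univ.mpr p.surjective, ← Set.image_univ]
    exact (IrreducibleSpace.isIrreducible_univ _).image _ p.continuous.continuousOn
  exact isIntegral_of_irreducibleSpace_of_isReduced _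

end Geometric

/-! ### Reduced closed subschemes and subgroup objects. -/

/-- A morphism from a reduced scheme factors through a closed immersion if it does so on points. -/
lemma exists_lift_of_range_subset {T X Z : Scheme.{u}} (g : T ⟶ X) (i : Z ⟶ X)
    [IsClosedImmersion i] [IsReduced T] (h : Set.range g ⊆ Set.range i) :
    ∃ l : T ⟶ Z, l ≫ i = g := by
  -- A surjective closed immersion into a reduced scheme is an isomorphism, so the pullback is `T`
  -- itself.
  have : Surjective (pullback.fst g i) := by
    refine ⟨fun t ↦ ?_⟩
    rw [← Set.mem_range, Scheme.Pullback.range_fst]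
    exact h ⟨t, rfl⟩
  have := isIso_of_isClosedImmersion_of_surjective (pullback.fst g i)
  exact ⟨inv (pullback.fst g i) ≫ pullback.snd g i, by simp [← pullback.condition]⟩

/-- The reduced closed subscheme with a given closed underlying set. -/
noncomputable abbrev reducedSubscheme {X : Scheme.{u}} (D : TopologicalSpace.Closeds X) : Scheme.{u} :=
  (Scheme.IdealSheafData.vanishingIdeal D).subscheme

noncomputable abbrev reducedSubschemeι {X : Scheme.{u}} (D : TopologicalSpace.Closeds X) :
    reducedSubscheme D ⟶ X :=
  (Scheme.IdealSheafData.vanishingIdeal D).subschemeι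

instance {X : Scheme.{u}} (D : TopologicalSpace.Closeds X) : IsReduced (reducedSubscheme D) := by
  apply +allowSynthFailures @IsReduced.of_openCover
    (𝒰 := (Scheme.IdealSheafData.vanishingIdeal D).subschemeCover.openCover)
  intro (U : X.affineOpens)
  have : _root_.IsReduced
      (Γ(X, U.1) ⧸ (Scheme.IdealSheafData.vanishingIdeal D).ideal U) := by
    rw [← Ideal.isRadical_iff_quotient_reduced, Scheme.IdealSheafData.vanishingIdeal_ideal]
    exact PrimeSpectrum.isRadical_vanishingIdeal _
  exact inferInstanceAs (IsReduced (Spec (.of _)))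

lemma range_reducedSubschemeι {X : Scheme.{u}} (D : TopologicalSpace.Closeds X) :
    Set.range (reducedSubschemeι D) = D := by
  simp

open MonoidalCategory CartesianMonoidalCategory MonObj
open AbelianVariety

section SubgroupObject

variable {C : Type*} [Category C] [CartesianMonoidalCategory C] {G Z : C} [GrpObj G]

/-- A subobject of a group object through which the group operations factor is a group object. -/
abbrev GrpObj.ofMono (i : Z ⟶ G) [Mono i] (e : 𝟙_ C ⟶ Z) (he : e ≫ i = η[G]) (m : Z ⊗ Z ⟶ Z)
    (hm : m ≫ i = (fst Z Z ≫ i) * (snd Z Z ≫ i)) (v : Z ⟶ Z) (hv : v ≫ i = i⁻¹) :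
    GrpObj Z where
  one := e
  mul := m
  inv := v
  one_mul := by
    rw [← cancel_mono i, Category.assoc, hm, comp_mul, whiskerRight_fst_assoc,
      whiskerRight_snd_assoc, he, one_eq_one, comp_one, _root_.one_mul, leftUnitor_hom]
  mul_one := by
    rw [← cancel_mono i, Category.assoc, hm, comp_mul, whiskerLeft_fst_assoc,
      whiskerLeft_snd_assoc, he, one_eq_one, comp_one, _root_.mul_one, rightUnitor_hom]
  mul_assoc := by
    rw [← cancel_mono i]
    simp only [Category.assoc, hm, comp_mul, whiskerRight_fst_assoc, whiskerRight_snd_assoc,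
      whiskerLeft_fst_assoc, whiskerLeft_snd_assoc, _root_.mul_assoc, associator_hom_fst_assoc,
      associator_hom_snd_fst_assoc, associator_hom_snd_snd_assoc]
  left_inv := by
    rw [← cancel_mono i, Category.assoc, Category.assoc, hm, comp_mul, lift_fst_assoc,
      lift_snd_assoc, he, hv, Category.id_comp, inv_mul_cancel, one_eq_one, comp_one]
  right_inv := by
    rw [← cancel_mono i, Category.assoc, Category.assoc, hm, comp_mul, lift_fst_assoc,
      lift_snd_assoc, he, hv, Category.id_comp, mul_inv_cancel, one_eq_one, comp_one]

lemma GrpObj.isMonHom_ofMono (i : Z ⟶ G) [Mono i] (e : 𝟙_ C ⟶ Z) (he : e ≫ i = η[G])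
    (m : Z ⊗ Z ⟶ Z) (hm : m ≫ i = (fst Z Z ≫ i) * (snd Z Z ≫ i)) (v : Z ⟶ Z) (hv : v ≫ i = i⁻¹) :
    letI := GrpObj.ofMono i e he m hm v hv
    IsMonHom i :=
  letI := GrpObj.ofMono i e he m hm v hv
  { one_hom := he
    mul_hom := by
      refine hm.trans ?_
      rw [mul_eq_mul, comp_mul, tensorHom_fst, tensorHom_snd] }

end SubgroupObject

/-! ### Closed subgroups, base change to `Kbar` and translations. -/

/-- A closed subset of a group scheme that is stable under the group operations on points with
values in reduced schemes. -/
structure IsClosedSubgroup {K : Type u} [Field K] (G : Over (Spec (.of K))) [GrpObj G]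
    (C : Set G.left) : Prop where
  isClosed : IsClosed C
  one : Set.range η[G].left ⊆ C
  mul : ∀ {T : Over (Spec (.of K))} [IsReduced T.left] (x y : T ⟶ G),
    Set.range x.left ⊆ C → Set.range y.left ⊆ C → Set.range (x * y).left ⊆ C
  inv : ∀ {T : Over (Spec (.of K))} [IsReduced T.left] (x : T ⟶ G),
    Set.range x.left ⊆ C → Set.range (x⁻¹).left ⊆ C

section BaseChange

variable {K : Type u} [Field K] (Kbar : Type u) [Field Kbar] [Algebra K Kbar]
  (G : Over (Spec (.of K)))

/-- The morphism `Spec Kbar ⟶ Spec K`. -/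
noncomputable abbrev specMap (K : Type u) [Field K] (Kbar : Type u) [Field Kbar] [Algebra K Kbar] :
    Spec (.of Kbar) ⟶ Spec (.of K) :=
  Spec.map (CommRingCat.ofHom (algebraMap K Kbar))

/-- The base change of a scheme over `K` to `Kbar`, as a scheme over `K`. -/
noncomputable abbrev baseChange : Over (Spec (.of K)) :=
  Over.mk (pullback.fst G.hom (specMap K Kbar) ≫ G.hom)

/-- The projection from the base change to the original scheme. -/
noncomputable abbrev baseChangeFst : baseChange Kbar G ⟶ G :=
  Over.homMk (pullback.fst G.hom (specMap K Kbar))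

/-- The projection from the base change to `Spec Kbar`. -/
noncomputable abbrev baseChangeSnd : baseChange Kbar G ⟶ specOver K Kbar :=
  Over.homMk (pullback.snd G.hom (specMap K Kbar)) pullback.condition.symm

variable {Kbar G}

/-- The morphism to the base change determined by its two components. -/
noncomputable def baseChangeLift {T : Over (Spec (.of K))} (x : T ⟶ G) (y : T ⟶ specOver K Kbar) :
    T ⟶ baseChange Kbar G :=
  Over.homMk (pullback.lift x.left y.left ((Over.w x).trans (Over.w y).symm))
    ((pullback.lift_fst_assoc _ _ _ _).trans (Over.w x))

@[simp]
lemma baseChangeLift_fst {T : Over (Spec (.of K))} (x : T ⟶ G) (y : T ⟶ specOver K Kbar) :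
    baseChangeLift x y ≫ baseChangeFst Kbar G = x := by
  ext1; exact pullback.lift_fst _ _ _

@[simp]
lemma baseChangeLift_snd {T : Over (Spec (.of K))} (x : T ⟶ G) (y : T ⟶ specOver K Kbar) :
    baseChangeLift x y ≫ baseChangeSnd Kbar G = y := by
  ext1; exact pullback.lift_snd _ _ _

lemma baseChange_hom_ext {T : Over (Spec (.of K))} {x y : T ⟶ baseChange Kbar G}
    (h₁ : x ≫ baseChangeFst Kbar G = y ≫ baseChangeFst Kbar G)
    (h₂ : x ≫ baseChangeSnd Kbar G = y ≫ baseChangeSnd Kbar G) : x = y := by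
  ext1
  apply pullback.hom_ext
  · exact congr_arg CommaMorphism.left h₁
  · exact congr_arg CommaMorphism.left h₂

variable [GrpObj G]

/-- Translation by a `Kbar`-point on the base change of a group scheme to `Kbar`. -/
noncomputable def translation (x : specOver K Kbar ⟶ G) : baseChange Kbar G ⟶ baseChange Kbar G :=
  baseChangeLift ((baseChangeSnd Kbar G ≫ x) * baseChangeFst Kbar G) (baseChangeSnd Kbar G)

lemma translation_fst (x : specOver K Kbar ⟶ G) :
    translation x ≫ baseChangeFst Kbar G = (baseChangeSnd Kbar G ≫ x) * baseChangeFst Kbar G := by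
  simp [translation]

@[simp]
lemma translation_snd (x : specOver K Kbar ⟶ G) :
    translation x ≫ baseChangeSnd Kbar G = baseChangeSnd Kbar G := by
  simp [translation]

lemma translation_comp (x y : specOver K Kbar ⟶ G) :
    translation x ≫ translation y = translation (y * x) := by
  apply baseChange_hom_ext
  · rw [Category.assoc, translation_fst, comp_mul, ← Category.assoc, translation_snd,
      translation_fst, translation_fst, comp_mul, _root_.mul_assoc]
  · simp

lemma translation_one : translation (1 : specOver K Kbar ⟶ G) = 𝟙 _ := by
  apply baseChange_hom_ext
  · simp [translation_fst]
  · simp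

/-- The section of the base change defined by a `Kbar`-point. -/
noncomputable abbrev pointSection (x : specOver K Kbar ⟶ G) : specOver K Kbar ⟶ baseChange Kbar G :=
  baseChangeLift x (𝟙 _)

lemma pointSection_translation (x y : specOver K Kbar ⟶ G) :
    pointSection x ≫ translation y = pointSection (y * x) := by
  apply baseChange_hom_ext
  · rw [Category.assoc, translation_fst, comp_mul, ← Category.assoc, baseChangeLift_snd,
      baseChangeLift_fst, baseChangeLift_fst, Category.id_comp]
  · simp

end BaseChange

section BaseChange

variable {K : Type u} [Field K] {Kbar : Type u} [Field Kbar] [Algebra K Kbar]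
  {G : Over (Spec (.of K))}

instance : Subsingleton (specOver K Kbar).left :=
  inferInstanceAs (Subsingleton (Spec (.of Kbar)))

instance : IsReduced (specOver K Kbar).left :=
  inferInstanceAs (IsReduced (Spec (.of Kbar)))

/-- The unique point of `Spec Kbar`. -/
noncomputable abbrev specPt (Kbar : Type u) [Field Kbar] : Spec (.of Kbar) :=
  IsLocalRing.closedPoint Kbar

lemma range_specOver_hom (x : specOver K Kbar ⟶ G) :
    Set.range x.left = {x.left (specPt Kbar)} := by
  ext z
  constructor
  · rintro ⟨w, rfl⟩
    exact congr_arg x.left (Subsingleton.elim (α := (specOver K Kbar).left) _ _)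
  · rintro rfl
    exact ⟨_, rfl⟩

/-- The underlying point of the base change defined by a `Kbar`-point. -/
noncomputable abbrev basePoint (x : specOver K Kbar ⟶ G) : (baseChange Kbar G).left :=
  (pointSection x).left (specPt Kbar)

lemma pointSection_fst_left_apply (x : specOver K Kbar ⟶ G) :
    (baseChangeFst Kbar G).left (basePoint x) = x.left (specPt Kbar) := by
  rw [basePoint, ← Scheme.Hom.comp_apply, ← Over.comp_left, baseChangeLift_fst]

lemma pointSection_snd (x : specOver K Kbar ⟶ G) :
    (pointSection x).left ≫ pullback.snd G.hom (specMap K Kbar) = 𝟙 _ :=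
  congr_arg CommaMorphism.left (baseChangeLift_snd x (𝟙 (specOver K Kbar)))

section LocallyOfFiniteType

variable [IsAlgClosed Kbar] [LocallyOfFiniteType G.hom]

lemma isClosed_basePoint (x : specOver K Kbar ⟶ G) : IsClosed {basePoint x} :=
  (pointEquivClosedPoint (pullback.snd G.hom (specMap K Kbar))
    ⟨(pointSection x).left, pointSection_snd x⟩).2

lemma basePoint_injective : Function.Injective (basePoint : (specOver K Kbar ⟶ G) → _) := by
  intro x y h
  have h1 : (pointSection x).left = (pointSection y).left :=
    ext_of_apply_closedPoint_eq (pullback.snd G.hom (specMap K Kbar)) (pointSection_snd x)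
      (pointSection_snd y) h
  have h2 : pointSection x = pointSection y := by ext1; exact h1
  exact (baseChangeLift_fst x _).symm.trans ((congr_arg (· ≫ baseChangeFst Kbar G) h2).trans
    (baseChangeLift_fst y _))

lemma exists_basePoint_eq (c : (baseChange Kbar G).left) (hc : IsClosed {c}) :
    ∃ x : specOver K Kbar ⟶ G, basePoint x = c := by
  have e := pointOfClosedPoint_comp (pullback.snd G.hom (specMap K Kbar)) c hc
  let s : specOver K Kbar ⟶ baseChange Kbar G :=
    Over.homMk (pointOfClosedPoint (pullback.snd G.hom (specMap K Kbar)) c hc) (by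
      change _ ≫ pullback.fst G.hom (specMap K Kbar) ≫ G.hom = specMap K Kbar
      rw [pullback.condition, reassoc_of% e])
  have hs : pointSection (s ≫ baseChangeFst Kbar G) = s := by
    apply baseChange_hom_ext
    · rw [baseChangeLift_fst]
    · rw [baseChangeLift_snd]
      ext1
      exact e.symm
  refine ⟨s ≫ baseChangeFst Kbar G, ?_⟩
  rw [basePoint, hs]
  exact pointOfClosedPoint_apply _ _ _ _

end LocallyOfFiniteType

/-- The fibre of the base change over the neutral element of a group scheme is one point. -/
lemma subsingleton_preimage_one [GrpObj G] :
    ((baseChangeFst Kbar G).left ⁻¹' Set.range η[G].left).Subsingleton := by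
  -- Pasting pullback squares identifies the fibre over the unit section with `Spec Kbar`, a single
  -- point.
  have h1 : IsPullback (𝟙 (Spec (.of Kbar))) (specMap K Kbar) (specMap K Kbar) (𝟙 (Spec (.of K))) :=
    IsPullback.of_horiz_isIso ⟨by simp⟩
  have h2 : IsPullback ((pointSection (1 : specOver K Kbar ⟶ G)).left ≫
      pullback.snd G.hom (specMap K Kbar)) (specMap K Kbar) (specMap K Kbar)
      (η[G].left ≫ G.hom) := by
    rw [pointSection_snd, show η[G].left ≫ G.hom = 𝟙 _ from Over.w η[G]]
    exact h1
  have h3 : IsPullback (pointSection (1 : specOver K Kbar ⟶ G)).left (specMap K Kbar)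
      (pullback.fst G.hom (specMap K Kbar)) η[G].left := by
    refine IsPullback.of_right h2 ?_ (IsPullback.of_hasPullback G.hom (specMap K Kbar)).flip
    have := congr_arg CommaMorphism.left
      (baseChangeLift_fst (1 : specOver K Kbar ⟶ G) (𝟙 (specOver K Kbar)))
    refine this.trans ?_
    rw [Hom.one_def]
    rfl
  have h4 : (baseChangeFst Kbar G).left ⁻¹' Set.range η[G].left =
      Set.range (pullback.fst (pullback.fst G.hom (specMap K Kbar)) η[G].left) :=
    (Scheme.Pullback.range_fst _ _).symm
  rw [h4, ← h3.isoPullback_inv_fst, Scheme.Hom.comp_base, TopCat.coe_comp]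
  rintro - ⟨a, rfl⟩ - ⟨b, rfl⟩
  exact congr_arg (pointSection (1 : specOver K Kbar ⟶ G)).left
    (Subsingleton.elim (α := (specOver K Kbar).left) _ _)

/-- The closed points of the base change that lie in a given subset. -/
def closedPointsIn (Kbar : Type u) [Field Kbar] [Algebra K Kbar] (C : Set G.left) :
    Set ↥((baseChangeFst Kbar G).left ⁻¹' C) :=
  {c | IsClosed {c.1}}

/-- Schemes locally of finite type over a field are Jacobson. This is the density hypothesis `hS` of
the homogeneity lemmas. -/
lemma inter_closedPointsIn_nonempty [LocallyOfFiniteType G.hom] {C : Set G.left} (hC : IsClosed C)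
    (Z : Set ↥((baseChangeFst Kbar G).left ⁻¹' C)) (hZ : IsLocallyClosed Z) (hne : Z.Nonempty) :
    (Z ∩ closedPointsIn Kbar C).Nonempty := by
  have : JacobsonSpace (baseChange Kbar G).left :=
    LocallyOfFiniteType.jacobsonSpace (pullback.snd G.hom (specMap K Kbar))
  have hcl : IsClosed ((baseChangeFst Kbar G).left ⁻¹' C) :=
    hC.preimage (baseChangeFst Kbar G).left.continuous
  obtain ⟨-, ⟨z, hz, rfl⟩, hz'⟩ := nonempty_inter_closedPoints (hne.image Subtype.val)
    (hZ.image Topology.IsInducing.subtypeVal (by rw [Subtype.range_val]; exact hcl.isLocallyClosed))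
  exact ⟨z, hz, hz'⟩

variable [GrpObj G] {C : Set G.left}

lemma mapsTo_translation (hC : IsClosedSubgroup G C) {x : specOver K Kbar ⟶ G}
    (hx : Set.range x.left ⊆ C) :
    Set.MapsTo (translation x).left ((baseChangeFst Kbar G).left ⁻¹' C)
      ((baseChangeFst Kbar G).left ⁻¹' C) := by
  -- The preimage of `C` with its reduced structure serves as a test scheme, so stability of `C`
  -- under multiplication applies to all its points at once.
  let D : TopologicalSpace.Closeds (baseChange Kbar G).left :=
    ⟨(baseChangeFst Kbar G).left ⁻¹' C, hC.isClosed.preimage (baseChangeFst Kbar G).left.continuous⟩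
  let T : Over (Spec (.of K)) := Over.mk (reducedSubschemeι D ≫ (baseChange Kbar G).hom)
  let j : T ⟶ baseChange Kbar G := Over.homMk (reducedSubschemeι D)
  have hT : IsReduced T.left := inferInstanceAs (IsReduced (reducedSubscheme D))
  have hj : Set.range j.left = (baseChangeFst Kbar G).left ⁻¹' C := range_reducedSubschemeι D
  have key : Set.range (j ≫ translation x ≫ baseChangeFst Kbar G).left ⊆ C := by
    rw [translation_fst, comp_mul]
    refine hC.mul _ _ ?_ ?_
    · rw [Over.comp_left, Over.comp_left, ← Category.assoc, Scheme.Hom.comp_base, TopCat.coe_comp]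
      exact (Set.range_comp_subset_range _ _).trans hx
    · rw [Over.comp_left, Scheme.Hom.comp_base, TopCat.coe_comp, Set.range_comp, hj]
      exact Set.image_preimage_subset _ _
  intro z hz
  obtain ⟨w, rfl⟩ := hj.ge hz
  have := key ⟨w, rfl⟩
  rwa [Over.comp_left, Over.comp_left, Scheme.Hom.comp_apply, Scheme.Hom.comp_apply] at this

lemma range_inv_subset (hC : IsClosedSubgroup G C) {x : specOver K Kbar ⟶ G}
    (hx : Set.range x.left ⊆ C) :
    Set.range (x⁻¹).left ⊆ C := hC.inv x hx

/-- Translation by a point of a closed subgroup as a self-homeomorphism of its base change. -/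
noncomputable def translationHomeomorph (hC : IsClosedSubgroup G C) {x : specOver K Kbar ⟶ G}
    (hx : Set.range x.left ⊆ C) :
    ↥((baseChangeFst Kbar G).left ⁻¹' C) ≃ₜ ↥((baseChangeFst Kbar G).left ⁻¹' C) where
  toFun := (mapsTo_translation hC hx).restrict
  invFun := (mapsTo_translation hC (range_inv_subset hC hx)).restrict
  left_inv z := by
    ext1
    simp only [Set.MapsTo.val_restrict_apply]
    rw [← Scheme.Hom.comp_apply, ← Over.comp_left, translation_comp, inv_mul_cancel,
      translation_one]
    rfl
  right_inv z := by
    ext1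
    simp only [Set.MapsTo.val_restrict_apply]
    rw [← Scheme.Hom.comp_apply, ← Over.comp_left, translation_comp, mul_inv_cancel,
      translation_one]
    rfl
  continuous_toFun := (translation x).left.continuous.restrict _
  continuous_invFun := (translation x⁻¹).left.continuous.restrict _

/-- Closed points are `Kbar`-points `x`, `y`, and translation by `y * x⁻¹` carries one to the other.
-/
lemma exists_homeomorph_of_closedPointsIn (hC : IsClosedSubgroup G C) [IsAlgClosed Kbar]
    [LocallyOfFiniteType G.hom] :
    ∀ c ∈ closedPointsIn Kbar C, ∀ d ∈ closedPointsIn Kbar C,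
      ∃ h : ↥((baseChangeFst Kbar G).left ⁻¹' C) ≃ₜ ↥((baseChangeFst Kbar G).left ⁻¹' C),
        h c = d := by
  rintro ⟨c, hcC⟩ hc ⟨d, hdC⟩ hd
  obtain ⟨x, rfl⟩ := exists_basePoint_eq c hc
  obtain ⟨y, rfl⟩ := exists_basePoint_eq d hd
  have hx : Set.range x.left ⊆ C := by
    rw [range_specOver_hom, ← pointSection_fst_left_apply]
    simpa using hcC
  have hy : Set.range y.left ⊆ C := by
    rw [range_specOver_hom, ← pointSection_fst_left_apply]
    simpa using hdC
  have hyx := hC.mul _ _ hy (range_inv_subset hC hx)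
  refine ⟨translationHomeomorph hC hyx, Subtype.ext ?_⟩
  change (translation (y * x⁻¹)).left ((pointSection x).left _) = _
  rw [← Scheme.Hom.comp_apply, ← Over.comp_left, pointSection_translation, inv_mul_cancel_right]

end BaseChange

/-! ### The identity component of a closed subgroup. -/

section Component

variable {K : Type u} [Field K] {G : Over (Spec (.of K))} [GrpObj G]

/-- The underlying point of the neutral element of a group scheme over a field. -/
noncomputable abbrev onePt (G : Over (Spec (.of K))) [GrpObj G] : G.left :=
  η[G].left (specPt K)

lemma range_one_left : Set.range η[G].left = {onePt G} := by
  ext z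
  constructor
  · rintro ⟨w, rfl⟩
    exact congr_arg η[G].left (Subsingleton.elim (α := Spec (.of K)) _ _)
  · rintro rfl
    exact ⟨_, rfl⟩

variable {C : Set G.left}

lemma IsClosedSubgroup.onePt_mem (hC : IsClosedSubgroup G C) : onePt G ∈ C :=
  hC.one ⟨_, rfl⟩

/-- The connected component of the neutral element in a closed subgroup. -/
noncomputable def identityComponent (hC : IsClosedSubgroup G C) : TopologicalSpace.Closeds G.left :=
  ⟨connectedComponentIn C (onePt G), by
    rw [connectedComponentIn_eq_image hC.onePt_mem]
    exact hC.isClosed.isClosedEmbedding_subtypeVal.isClosedMap _ isClosed_connectedComponent⟩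

lemma identityComponent_subset (hC : IsClosedSubgroup G C) :
    (identityComponent hC : Set G.left) ⊆ C :=
  connectedComponentIn_subset _ _

lemma onePt_mem_identityComponent (hC : IsClosedSubgroup G C) :
    onePt G ∈ identityComponent hC :=
  mem_connectedComponentIn hC.onePt_mem

variable {Kbar : Type u} [Field Kbar] [Algebra K Kbar]

lemma baseChangeFst_basePoint_one :
    (baseChangeFst Kbar G).left (basePoint (1 : specOver K Kbar ⟶ G)) = onePt G := by
  rw [pointSection_fst_left_apply]
  have : (1 : specOver K Kbar ⟶ G).left = specMap K Kbar ≫ η[G].left := by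
    rw [Hom.one_def]; rfl
  rw [this, Scheme.Hom.comp_apply]
  exact congr_arg η[G].left (Subsingleton.elim (α := Spec (.of K)) _ _)

/-- The neutral point of the base change, as a point of the base change of a closed subgroup. -/
noncomputable def oneIn (Kbar : Type u) [Field Kbar] [Algebra K Kbar] (hC : IsClosedSubgroup G C) :
    ↥((baseChangeFst Kbar G).left ⁻¹' C) :=
  ⟨basePoint (1 : specOver K Kbar ⟶ G), by
    rw [Set.mem_preimage, baseChangeFst_basePoint_one]; exact hC.onePt_mem⟩

/-- The preimage of the identity component is the identity component of the preimage. -/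
lemma preimage_identityComponent [Algebra.IsAlgebraic K Kbar] (hC : IsClosedSubgroup G C) :
    (baseChangeFst Kbar G).left ⁻¹' (identityComponent hC) =
      Subtype.val '' connectedComponent (oneIn Kbar hC) := by
  rw [oneIn, ← connectedComponentIn_eq_image (F := (baseChangeFst Kbar G).left ⁻¹' C)]
  have : IsIntegralHom (specMap K Kbar) := by
    rw [IsIntegralHom.SpecMap_iff]
    exact algebraMap_isIntegral_iff.mpr inferInstance
  have ho : IsOpenMap (baseChangeFst Kbar G).left :=
    (pullback.fst G.hom (specMap K Kbar)).isOpenMap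
  have hc : IsClosedMap (baseChangeFst Kbar G).left :=
    (pullback.fst G.hom (specMap K Kbar)).isClosedMap
  apply Set.Subset.antisymm
  -- The projection is open and closed with a one-point fibre over the neutral element, so the
  -- preimage stays connected.
  · refine IsPreconnected.subset_connectedComponentIn ?_ ?_ ?_
    · refine isPreconnected_preimage_of_subsingleton_fiber ho hc isPreconnected_connectedComponentIn
        (onePt_mem_identityComponent hC) ?_
      rw [← range_one_left]
      exact subsingleton_preimage_one
    · rw [Set.mem_preimage]
      rw [baseChangeFst_basePoint_one]
      exact onePt_mem_identityComponent hC
    · exact Set.preimage_mono (identityComponent_subset hC)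
  · rw [← Set.image_subset_iff]
    refine IsPreconnected.subset_connectedComponentIn ?_ ?_ ?_
    · exact isPreconnected_connectedComponentIn.image _
        (baseChangeFst Kbar G).left.continuous.continuousOn
    · exact ⟨_, mem_connectedComponentIn (oneIn Kbar hC).2, baseChangeFst_basePoint_one⟩
    · rw [Set.image_subset_iff]
      exact connectedComponentIn_subset _ _

variable [IsAlgClosed Kbar] [LocallyOfFiniteType G.hom] [QuasiCompact G.hom]

instance : TopologicalSpace.NoetherianSpace (baseChange Kbar G).left := by
  have : IsLocallyNoetherian (pullback G.hom (specMap K Kbar)) :=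
    LocallyOfFiniteType.isLocallyNoetherian (pullback.snd G.hom (specMap K Kbar))
  have : CompactSpace ↥(pullback G.hom (specMap K Kbar)) :=
    QuasiCompact.compactSpace_of_compactSpace (pullback.snd G.hom (specMap K Kbar))
  have : IsNoetherian (pullback G.hom (specMap K Kbar)) := {}
  exact inferInstanceAs (TopologicalSpace.NoetherianSpace ↥(pullback G.hom (specMap K Kbar)))

instance : TopologicalSpace.NoetherianSpace ↥((baseChangeFst Kbar G).left ⁻¹' C) :=
  TopologicalSpace.NoetherianSpace.set _

lemma isIrreducible_preimage_identityComponent [Algebra.IsAlgebraic K Kbar]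
    (hC : IsClosedSubgroup G C) :
    IsIrreducible ((baseChangeFst Kbar G).left ⁻¹' (identityComponent hC)) := by
  rw [preimage_identityComponent]
  refine IsIrreducible.image ?_ _ continuous_subtype_val.continuousOn
  exact isIrreducible_connectedComponent_of_homogeneous (inter_closedPointsIn_nonempty hC.isClosed)
    (exists_homeomorph_of_closedPointsIn hC) _

/-- A closed subgroup whose identity component is trivial has finitely many geometric points. -/
lemma finite_points_of_identityComponent_eq [Algebra.IsAlgebraic K Kbar]
    (hC : IsClosedSubgroup G C) (h : (identityComponent hC : Set G.left) = {onePt G}) :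
    {x : specOver K Kbar ⟶ G | Set.range x.left ⊆ C}.Finite := by
  have h1 : connectedComponent (oneIn Kbar hC) ⊆ {oneIn Kbar hC} := by
    have h2 : (Subtype.val '' connectedComponent (oneIn Kbar hC)).Subsingleton := by
      rw [← preimage_identityComponent, h, ← range_one_left]
      exact subsingleton_preimage_one
    intro z hz
    exact Subtype.ext (h2 ⟨z, hz, rfl⟩ ⟨_, mem_connectedComponent, rfl⟩)
  have h2 := finite_of_connectedComponent_eq_singleton
    (exists_homeomorph_of_closedPointsIn hC) (isClosed_basePoint 1 : oneIn Kbar hC ∈ _) h1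
  refine Set.Finite.of_finite_image ((h2.image Subtype.val).subset ?_) basePoint_injective.injOn
  rintro - ⟨x, hx, rfl⟩
  refine ⟨⟨basePoint x, ?_⟩, isClosed_basePoint x, rfl⟩
  rw [Set.mem_preimage, pointSection_fst_left_apply]
  exact hx ⟨_, rfl⟩

end Component

/-! ### The identity component as an abelian subvariety. -/

section Subgroup

variable {K : Type u} [Field K] {G : Over (Spec (.of K))} [GrpObj G] {C : Set G.left}

/-- The identity component of a closed subgroup, as a reduced scheme over `K`. -/
noncomputable abbrev identityComponentOver (hC : IsClosedSubgroup G C) : Over (Spec (.of K)) :=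
  Over.mk (reducedSubschemeι (identityComponent hC) ≫ G.hom)

/-- The inclusion of the identity component of a closed subgroup. -/
noncomputable abbrev identityComponentι (hC : IsClosedSubgroup G C) :
    identityComponentOver hC ⟶ G :=
  Over.homMk (reducedSubschemeι (identityComponent hC))

lemma range_identityComponentι (hC : IsClosedSubgroup G C) :
    Set.range (identityComponentι hC).left = identityComponent hC :=
  range_reducedSubschemeι _

instance (hC : IsClosedSubgroup G C) : IsClosedImmersion (identityComponentι hC).left :=
  inferInstanceAs (IsClosedImmersion (reducedSubschemeι _))

instance (hC : IsClosedSubgroup G C) : Mono (identityComponentι hC) :=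
  have : Mono ((Over.forget _).map (identityComponentι hC)) :=
    inferInstanceAs (Mono (identityComponentι hC).left)
  (Over.forget _).mono_of_mono_map this

instance (hC : IsClosedSubgroup G C) : IsReduced (identityComponentOver hC).left :=
  inferInstanceAs (IsReduced (reducedSubscheme _))

lemma geometricallyIntegral_identityComponent [CharZero K] [LocallyOfFiniteType G.hom]
    [QuasiCompact G.hom] (hC : IsClosedSubgroup G C) :
    GeometricallyIntegral (identityComponentOver hC).hom := by
  let Kbar := AlgebraicClosure K
  let i := reducedSubschemeι (identityComponent hC)
  have : IsLocallyNoetherian (reducedSubscheme (identityComponent hC)) :=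
    LocallyOfFiniteType.isLocallyNoetherian (i ≫ G.hom)
  -- Characteristic zero enters here: `Kbar/K` is separable, so the base change stays reduced.
  have : IsReduced (pullback (i ≫ G.hom) (specMap K Kbar)) := inferInstance
  let j : pullback (i ≫ G.hom) (specMap K Kbar) ⟶ pullback G.hom (specMap K Kbar) :=
    (pullbackRightPullbackFstIso G.hom (specMap K Kbar) i).inv ≫
      pullback.snd i (pullback.fst G.hom (specMap K Kbar))
  have hj' : IsClosedImmersion j := inferInstance
  have hr : Set.range j = (pullback.fst G.hom (specMap K Kbar)) ⁻¹' (identityComponent hC) := by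
    rw [Scheme.Hom.comp_base, TopCat.coe_comp, Set.range_comp,
      Set.range_eq_univ.mpr (Scheme.Hom.surjective _), Set.image_univ, Scheme.Pullback.range_snd,
      range_reducedSubschemeι]
  have hirr : IsIrreducible (Set.range j) := by
    rw [hr]
    exact isIrreducible_preimage_identityComponent (Kbar := Kbar) hC
  have : IrreducibleSpace ↥(pullback (i ≫ G.hom) (specMap K Kbar)) := by
    rw [j.isClosedEmbedding.isEmbedding.toHomeomorph.irreducibleSpace_iff]
    exact Subtype.irreducibleSpace hirr
  have : IsIntegral (pullback (i ≫ G.hom) (specMap K Kbar)) :=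
    isIntegral_of_irreducibleSpace_of_isReduced _
  exact geometricallyIntegral_of_isIntegral_pullback Kbar (i ≫ G.hom)

/-- A morphism from a connected reduced scheme to a closed subgroup whose image contains the neutral
element factors through the identity component. -/
lemma exists_lift_identityComponent (hC : IsClosedSubgroup G C) {T : Over (Spec (.of K))}
    [IsReduced T.left] [PreconnectedSpace T.left] (x : T ⟶ G) (hx : Set.range x.left ⊆ C)
    (h1 : onePt G ∈ Set.range x.left) : ∃ l : T ⟶ identityComponentOver hC,
      l ≫ identityComponentι hC = x := by
  have hsub : Set.range x.left ⊆ Set.range (identityComponentι hC).left := by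
    rw [range_identityComponentι]
    exact (isPreconnected_range x.left.continuous).subset_connectedComponentIn h1 hx
  obtain ⟨l, hl⟩ := exists_lift_of_range_subset _ _ hsub
  refine ⟨Over.homMk l ?_, by ext1; exact hl⟩
  change l ≫ (identityComponentι hC).left ≫ G.hom = T.hom
  rw [reassoc_of% hl, Over.w]

lemma range_comp_left_subset {H T U : Over (Spec (.of K))} {C : Set H.left} (f : T ⟶ U)
    (x : U ⟶ H) (hx : Set.range x.left ⊆ C) : Set.range (f ≫ x).left ⊆ C := by
  rw [Over.comp_left, Scheme.Hom.comp_base, TopCat.coe_comp]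
  exact (Set.range_comp_subset_range _ _).trans hx

lemma onePt_mem_range_of_section {T : Over (Spec (.of K))} (e : 𝟙_ _ ⟶ T) (x : T ⟶ G)
    (h : e ≫ x = η[G]) : onePt G ∈ Set.range x.left := by
  rw [onePt, ← h]
  exact ⟨e.left (specPt K), by rw [Over.comp_left, Scheme.Hom.comp_apply]⟩

/-- The identity component of a closed subgroup is a group scheme. -/
lemma exists_grpObj_identityComponent [CharZero K] [LocallyOfFiniteType G.hom]
    [QuasiCompact G.hom] (hC : IsClosedSubgroup G C) :
    ∃ _ : GrpObj (identityComponentOver hC), IsMonHom (identityComponentι hC) := by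
  let Z := identityComponentOver hC
  let i := identityComponentι hC
  have hgi : GeometricallyIntegral Z.hom := geometricallyIntegral_identityComponent hC
  have hft : LocallyOfFiniteType Z.hom :=
    inferInstanceAs (LocallyOfFiniteType (reducedSubschemeι (identityComponent hC) ≫ G.hom))
  have : IsLocallyNoetherian Z.left := LocallyOfFiniteType.isLocallyNoetherian Z.hom
  have : IsIntegral Z.left := GeometricallyIntegral.isIntegral_of_subsingleton Z.hom
  -- Geometric integrality makes `Z × Z` reduced and connected, as needed to factor multiplication
  -- through `Z`.
  have : IsIntegral (Z ⊗ Z).left := inferInstanceAs (IsIntegral (pullback Z.hom Z.hom))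
  have : IsReduced (𝟙_ (Over (Spec (.of K)))).left := inferInstanceAs (IsReduced (Spec (.of K)))
  have : PreconnectedSpace (𝟙_ (Over (Spec (.of K)))).left :=
    inferInstanceAs (PreconnectedSpace (Spec (.of K)))
  have hi : Set.range i.left ⊆ C := (range_identityComponentι hC).trans_subset
    (identityComponent_subset hC)
  obtain ⟨e, he⟩ := exists_lift_identityComponent hC η[G] hC.one ⟨_, rfl⟩
  obtain ⟨m, hm⟩ := exists_lift_identityComponent hC ((fst Z Z ≫ i) * (snd Z Z ≫ i))
    (hC.mul _ _ (range_comp_left_subset _ _ hi) (range_comp_left_subset _ _ hi))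
    (onePt_mem_range_of_section (lift e e) _ (by
      rw [comp_mul, lift_fst_assoc, lift_snd_assoc, he, one_eq_one, _root_.mul_one]))
  obtain ⟨v, hv⟩ := exists_lift_identityComponent hC i⁻¹ (hC.inv _ hi)
    (onePt_mem_range_of_section e _ (by rw [GrpObj.comp_inv, he, one_eq_one, inv_one]))
  exact ⟨GrpObj.ofMono i e he m hm v hv, GrpObj.isMonHom_ofMono i e he m hm v hv⟩

end Subgroup

/-- A proper closed subgroup of a simple abelian variety in characteristic zero has finitely many
geometric points. -/
lemma AbelianVariety.IsSimple.finite_points_of_ne_univ {K : Type u} [Field K] [CharZero K]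
    {A : AbelianVariety K} (hA : A.IsSimple) {C : Set A.toGroupScheme.X.left}
    (hC : IsClosedSubgroup A.toGroupScheme.X C) (hne : C ≠ Set.univ) (Kbar : Type u) [Field Kbar]
    [Algebra K Kbar] [IsAlgClosure K Kbar] :
    {x : specOver K Kbar ⟶ A.toGroupScheme.X | Set.range x.left ⊆ C}.Finite := by
  have : IsAlgClosed Kbar := IsAlgClosure.isAlgClosed K
  have : Algebra.IsAlgebraic K Kbar := IsAlgClosure.isAlgebraic
  have hproper := A.isProper
  obtain ⟨hgrp, hmon⟩ := exists_grpObj_identityComponent hC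
  let B : A.Subvariety :=
    { toAbelianVariety :=
        { toGroupScheme := ⟨identityComponentOver hC⟩
          isProper := inferInstanceAs
            (IsProper (reducedSubschemeι (identityComponent hC) ≫ A.toGroupScheme.X.hom))
          geometricallyIntegral := geometricallyIntegral_identityComponent hC }
      incl := Grp.homMk' { hom := identityComponentι hC }
      isClosedImmersion := inferInstanceAs (IsClosedImmersion (identityComponentι hC).left) }
  refine finite_points_of_identityComponent_eq hC ?_
  have hB : B.IsProperSub := by
    intro h
    have h1 : IsIso (identityComponentι hC).left := h
    apply hne
    rw [Set.eq_univ_iff_forall]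
    intro z
    obtain ⟨w, rfl⟩ := (identityComponentι hC).left.surjective z
    exact identityComponent_subset hC ((range_identityComponentι hC).le ⟨w, rfl⟩)
  -- By simplicity the identity component is `Spec K`, hence a single point, and homogeneity gives
  -- finiteness.
  have htriv : IsIso (identityComponentOver hC).hom := hA.eq_zero_or_eq_self B hB
  rw [← range_identityComponentι]
  have hmem : onePt A.toGroupScheme.X ∈ Set.range (identityComponentι hC).left := by
    rw [range_identityComponentι]; exact onePt_mem_identityComponent hC
  refine Set.Subset.antisymm ?_ (by simpa using hmem)
  obtain ⟨w, hw⟩ := hmem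
  rintro - ⟨z, rfl⟩
  rw [← hw]
  congr 1
  exact (identityComponentOver hC).hom.homeomorph.injective
    (Subsingleton.elim (α := Spec (.of K)) _ _)

/-! ### Preimages of subvarieties and the factors of the product. -/

section Factorization

variable {K : Type u} [Field K]

lemma exists_over_lift_of_range_subset {S : Scheme.{u}} {T G Z : Over S} (x : T ⟶ G) (i : Z ⟶ G)
    [IsClosedImmersion i.left] [IsReduced T.left] (h : Set.range x.left ⊆ Set.range i.left) :
    ∃ l : T ⟶ Z, l ≫ i = x := by
  obtain ⟨l, hl⟩ := exists_lift_of_range_subset _ _ h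
  refine ⟨Over.homMk l ?_, by ext1; exact hl⟩
  rw [← Over.w x, ← hl, Category.assoc, Over.w]

lemma range_comp_left_subset_range {S : Scheme.{u}} {T G Z : Over S} (l : T ⟶ Z) (i : Z ⟶ G) :
    Set.range (l ≫ i).left ⊆ Set.range i.left := by
  rw [Over.comp_left, Scheme.Hom.comp_base, TopCat.coe_comp]
  exact Set.range_comp_subset_range _ _

lemma range_subset_preimage_iff {S : Scheme.{u}} {T G H : Over S} (x : T ⟶ G) (f : G ⟶ H)
    (C : Set H.left) : Set.range x.left ⊆ f.left ⁻¹' C ↔ Set.range (x ≫ f).left ⊆ C := by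
  rw [← Set.image_subset_iff, ← Set.range_comp, Over.comp_left, Scheme.Hom.comp_base,
    TopCat.coe_comp]

/-- The preimage of a closed subgroup scheme under a homomorphism is a closed subgroup. -/
lemma isClosedSubgroup_preimage {G H Z : Over (Spec (.of K))} [GrpObj G] [GrpObj H] [GrpObj Z]
    (f : G ⟶ H) [IsMonHom f] (i : Z ⟶ H) [IsMonHom i] [IsClosedImmersion i.left] :
    IsClosedSubgroup G (f.left ⁻¹' Set.range i.left) where
  isClosed := i.left.isClosedEmbedding.isClosed_range.preimage f.left.continuous
  one := by
    rw [range_subset_preimage_iff, IsMonHom.one_hom f, ← IsMonHom.one_hom i]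
    exact range_comp_left_subset_range _ _
  mul x y hx hy := by
    rw [range_subset_preimage_iff] at hx hy ⊢
    obtain ⟨a, ha⟩ := exists_over_lift_of_range_subset _ _ hx
    obtain ⟨b, hb⟩ := exists_over_lift_of_range_subset _ _ hy
    rw [mul_comp, ← ha, ← hb, ← mul_comp]
    exact range_comp_left_subset_range _ _
  inv x hx := by
    rw [range_subset_preimage_iff] at hx ⊢
    obtain ⟨a, ha⟩ := exists_over_lift_of_range_subset _ _ hx
    rw [GrpObj.inv_comp, ← ha, ← GrpObj.inv_comp]
    exact range_comp_left_subset_range _ _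

instance AbelianVariety.isReduced (A : AbelianVariety K) : IsReduced A.toGroupScheme.X.left := by
  have := A.isProper
  have := A.geometricallyIntegral
  have : IsLocallyNoetherian A.toGroupScheme.X.left :=
    LocallyOfFiniteType.isLocallyNoetherian A.toGroupScheme.X.hom
  have : IsIntegral A.toGroupScheme.X.left :=
    GeometricallyIntegral.isIntegral_of_subsingleton A.toGroupScheme.X.hom
  infer_instance

/-- The set of points of `A'` that a homomorphism maps into a given abelian subvariety of `A`. -/
noncomputable def AbelianVariety.Subvariety.comap {A A' : AbelianVariety K} (B : A.Subvariety)
    (f : A'.toGroupScheme ⟶ A.toGroupScheme) : Set A'.toGroupScheme.X.left :=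
  f.hom.hom.left ⁻¹' Set.range B.incl.hom.hom.left

lemma AbelianVariety.Subvariety.isClosedSubgroup_comap {A A' : AbelianVariety K} (B : A.Subvariety)
    (f : A'.toGroupScheme ⟶ A.toGroupScheme) :
    IsClosedSubgroup A'.toGroupScheme.X (B.comap f) :=
  have : IsClosedImmersion B.incl.hom.hom.left := B.isClosedImmersion
  isClosedSubgroup_preimage f.hom.hom B.incl.hom.hom

/-- The inclusion of a factor into a finite product of abelian varieties. -/
noncomputable def factorInclusion {k : ℕ} (A' : Fin k → AbelianVariety K) (i : Fin k) :
    (A' i).toGroupScheme ⟶ ∏ᶜ fun i => (A' i).toGroupScheme :=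
  Pi.lift fun j ↦ if h : i = j then eqToHom (h ▸ rfl) else 1

lemma exists_isLimit_product {k : ℕ} (A' : Fin k → AbelianVariety K) :
    Nonempty (IsLimit (Fan.mk (∏ᶜ fun i => (A' i).toGroupScheme).X
      fun j ↦ (Pi.π (fun i => (A' i).toGroupScheme) j).hom.hom)) :=
  ⟨isLimitFanMkObjOfIsLimit (Grp.forget (Over (Spec (.of K)))) _ _
    (productIsProduct fun i => (A' i).toGroupScheme)⟩

/-- The identity of a finite product of abelian varieties is the product of the projections onto
its factors. -/
lemma prod_factorInclusion {k : ℕ} (A' : Fin k → AbelianVariety K) :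
    (List.ofFn fun i ↦ ((Pi.π (fun i => (A' i).toGroupScheme) i).hom.hom ≫
      (factorInclusion A' i).hom.hom)).prod =
      𝟙 (∏ᶜ fun i => (A' i).toGroupScheme).X := by
  have hπ (i j : Fin k) : (factorInclusion A' i).hom.hom ≫
      (Pi.π (fun i => (A' i).toGroupScheme) j).hom.hom =
      (if h : i = j then eqToHom (h ▸ rfl) else 1 :
        (A' i).toGroupScheme ⟶ (A' j).toGroupScheme).hom.hom :=
    congr_arg (fun g : (A' i).toGroupScheme ⟶ (A' j).toGroupScheme ↦ g.hom.hom)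
      (Pi.lift_π (f := fun i => (A' i).toGroupScheme) _ j)
  obtain ⟨hlim⟩ := exists_isLimit_product A'
  refine Fan.IsLimit.hom_ext hlim _ _ fun j ↦ ?_
  let φ := IsMonHom.monoidHom (Pi.π (fun i => (A' i).toGroupScheme) j).hom.hom
    (∏ᶜ fun i => (A' i).toGroupScheme).X
  have hφ (i : Fin k) : (φ ∘ fun i ↦ (Pi.π (fun i => (A' i).toGroupScheme) i).hom.hom ≫
      (factorInclusion A' i).hom.hom) i = (Pi.π (fun i => (A' i).toGroupScheme) i).hom.hom ≫
        (factorInclusion A' i).hom.hom ≫ (Pi.π (fun i => (A' i).toGroupScheme) j).hom.hom :=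
    Category.assoc (Pi.π (fun i => (A' i).toGroupScheme) i).hom.hom
      (factorInclusion A' i).hom.hom (Pi.π (fun i => (A' i).toGroupScheme) j).hom.hom
  -- After projection to the factor `j`, only the `j`-th term of the product is nontrivial.
  change φ _ = 𝟙 _ ≫ (Pi.π (fun i => (A' i).toGroupScheme) j).hom.hom
  rw [map_list_prod, List.map_ofFn, List.prod_ofFn, Category.id_comp, Finset.prod_eq_single j]
  · rw [hφ, hπ, dif_pos rfl]
    exact Category.comp_id _
  · intro i _ hij
    rw [hφ, hπ, dif_neg hij]
    exact comp_one _
  · simp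

/-- If a homomorphism from a finite product of abelian varieties to `A` is surjective, then some
factor is not mapped into a given proper abelian subvariety. -/
lemma exists_comap_ne_univ {A : AbelianVariety K} {k : ℕ} (A' : Fin k → AbelianVariety K)
    (α : (∏ᶜ fun i => (A' i).toGroupScheme) ⟶ A.toGroupScheme)
    (hα : Surjective (GroupScheme.homLeft α)) (B : A.Subvariety) (hB : B.IsProperSub) :
    ∃ i, B.comap (factorInclusion A' i ≫ α) ≠ Set.univ := by
  by_contra! H
  have : IsClosedImmersion B.incl.hom.hom.left := B.isClosedImmersion
  have h1 (i) : ∃ l : (A' i).toGroupScheme.X ⟶ B.toAbelianVariety.toGroupScheme.X,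
      l ≫ B.incl.hom.hom = (factorInclusion A' i ≫ α).hom.hom := by
    refine exists_over_lift_of_range_subset _ _ ?_
    rintro - ⟨z, rfl⟩
    exact (H i).ge (Set.mem_univ z)
  choose l hl using h1
  let P := ∏ᶜ fun i => (A' i).toGroupScheme
  let φ := IsMonHom.monoidHom α.hom.hom P.X
  let ψ := IsMonHom.monoidHom B.incl.hom.hom P.X
  -- If every factor maps into `B`, so does their product: `α` factors through `B`, and surjectivity
  -- forces `B = A`.
  have h2 : α.hom.hom = (List.ofFn fun i ↦
      (Pi.π (fun i => (A' i).toGroupScheme) i).hom.hom ≫ l i).prod ≫ B.incl.hom.hom := by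
    rw [← Category.id_comp α.hom.hom, ← prod_factorInclusion]
    change φ _ = ψ _
    rw [map_list_prod, map_list_prod, List.map_ofFn, List.map_ofFn]
    congr 2
    ext1 i
    change (_ ≫ _) ≫ α.hom.hom = (_ ≫ _) ≫ B.incl.hom.hom
    rw [Category.assoc, Category.assoc, hl]
    rfl
  have h3 : Surjective B.incl.hom.hom.left := by
    have h4 : Surjective α.hom.hom.left := hα
    rw [h2, Over.comp_left] at h4
    exact Surjective.of_comp (List.ofFn fun i ↦
      (Pi.π (fun i => (A' i).toGroupScheme) i).hom.hom ≫ l i).prod.left _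
  exact hB (isIso_of_isClosedImmersion_of_surjective B.incl.hom.hom.left)

end Factorization

/-! ### Rational points: functoriality and Galois descent. -/

section Points

variable {K : Type u} [Field K] {L M N : Type u} [Field L] [Field M] [Field N]
  [Algebra K L] [Algebra K M] [Algebra K N]

lemma specOverMap_comp (φ : L →ₐ[K] M) (ψ : M →ₐ[K] N) :
    specOverMap (ψ.comp φ) = specOverMap ψ ≫ specOverMap φ := by
  ext1
  simp only [Over.comp_left, Over.homMk_left, ← Spec.map_comp]
  rfl

lemma specOverMap_injective :
    Function.Injective (specOverMap : (L →ₐ[K] M) → (specOver K M ⟶ specOver K L)) := by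
  intro φ ψ h
  have h1 : Spec.map (CommRingCat.ofHom φ.toRingHom) = Spec.map (CommRingCat.ofHom ψ.toRingHom) :=
    congr_arg CommaMorphism.left h
  have h2 := congr_arg CommRingCat.Hom.hom (Spec.map_injective h1)
  ext a
  exact congr($h2 a)

/-- A flat surjective morphism between these spectra is an epimorphism; this is why `A(L) → A(M)` is
injective. -/
instance (φ : L →ₐ[K] M) : Epi (specOverMap φ) := by
  let := φ.toRingHom.toAlgebra
  have : Surjective (Spec.map (CommRingCat.ofHom (algebraMap L M))) := inferInstance
  have : Flat (Spec.map (CommRingCat.ofHom (algebraMap L M))) := inferInstance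
  have : Epi (Spec.map (CommRingCat.ofHom (algebraMap L M))) := Flat.epi_of_flat_of_surjective _
  have : Epi ((Over.forget _).map (specOverMap φ)) := this
  exact (Over.forget _).epi_of_epi_map this

variable (A : AbelianVariety K)

lemma Points.map_map (φ : L →ₐ[K] M) (ψ : M →ₐ[K] N) (x : A.Points L) :
    Points.map A ψ (Points.map A φ x) = Points.map A (ψ.comp φ) x := by
  change Points.ofHom (specOverMap ψ ≫ specOverMap φ ≫ x.toHom) =
    Points.ofHom (specOverMap (ψ.comp φ) ≫ x.toHom)
  rw [specOverMap_comp, Category.assoc]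

lemma Points.map_injective (φ : L →ₐ[K] M) : Function.Injective (Points.map A φ) := by
  intro x y h
  exact (cancel_epi (specOverMap φ)).mp h

variable {A} {A' : AbelianVariety K}

/-- The homomorphism on points induced by a homomorphism of abelian varieties. -/
noncomputable def Points.push (f : A'.toGroupScheme ⟶ A.toGroupScheme) (L : Type u) [Field L]
    [Algebra K L] : A'.Points L →+ A.Points L where
  toFun x := Points.ofHom (x.toHom ≫ f.hom.hom)
  map_zero' := congrArg Points.ofHom (one_comp f.hom.hom)
  map_add' x y := congrArg Points.ofHom (mul_comp x.toHom y.toHom f.hom.hom)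

lemma Points.map_push (f : A'.toGroupScheme ⟶ A.toGroupScheme) (φ : L →ₐ[K] M) (x : A'.Points L) :
    Points.map A φ (Points.push f L x) = Points.push f M (Points.map A' φ x) :=
  congrArg Points.ofHom (Category.assoc (specOverMap φ) x.toHom f.hom.hom).symm

/-- The points of an abelian subvariety as a subgroup. -/
noncomputable def Subvariety.pointsSubgroup (B : A.Subvariety) (L : Type u) [Field L]
    [Algebra K L] : AddSubgroup (A.Points L) :=
  (Points.push B.incl L).range

/-- A point whose image lies in a subvariety has finite order if its factor is simple and not
contained in the preimage of the subvariety. -/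
lemma isOfFinAddOrder_of_push_mem [CharZero K] (hA' : A'.IsSimple) (B : A.Subvariety)
    (f : A'.toGroupScheme ⟶ A.toGroupScheme) (hne : B.comap f ≠ Set.univ) {Kbar : Type u}
    [Field Kbar] [Algebra K Kbar] [IsAlgClosure K Kbar] (x : A'.Points Kbar)
    (hx : Points.push f Kbar x ∈ Subvariety.pointsSubgroup B Kbar) : IsOfFinAddOrder x := by
  have hfin := hA'.finite_points_of_ne_univ (B.isClosedSubgroup_comap f) hne Kbar
  have hfin' : {y : A'.Points Kbar | Set.range y.toHom.left ⊆ B.comap f}.Finite := hfin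
  by_contra h
  rw [← injective_nsmul_iff_not_isOfFinAddOrder] at h
  -- All multiples of `x` lie in the finite preimage of `B`, so they cannot be pairwise distinct.
  refine (Set.infinite_range_of_injective h) (hfin'.subset ?_)
  rintro - ⟨n, rfl⟩
  obtain ⟨z, hz⟩ : Points.push f Kbar (n • x) ∈ Subvariety.pointsSubgroup B Kbar := by
    rw [map_nsmul]
    exact AddSubgroup.nsmul_mem _ hx n
  have hz' : z.toHom ≫ B.incl.hom.hom = (n • x).toHom ≫ f.hom.hom := hz
  refine (range_subset_preimage_iff _ _ _).mpr ?_
  rw [← hz']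
  exact range_comp_left_subset_range _ _

/-- A point of an abelian variety with values in an algebraic extension factors through a
monomorphism from the spectrum of a finite extension. -/
lemma exists_mono_factorization [Algebra.IsAlgebraic K L] (X : Over (Spec (.of K)))
    [LocallyOfFiniteType X.hom] [IsSeparated X.hom] (x : specOver K L ⟶ X) :
    ∃ (κ : Type u) (_ : Field κ) (_ : Algebra K κ) (_ : FiniteDimensional K κ) (ψ : κ →ₐ[K] L)
      (y : specOver K κ ⟶ X), Mono y ∧ x = specOverMap ψ ≫ y := by
  let pt := x.left (specPt L)
  -- Integrality of `Spec L ⟶ X` makes its image point closed, so the residue field there is finite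
  -- over `K` and can serve as `κ`.
  have hint : IsIntegralHom (x.left ≫ X.hom) := by
    rw [Over.w]
    refine (IsIntegralHom.SpecMap_iff).mpr ?_
    exact algebraMap_isIntegral_iff.mpr inferInstance
  have : IsIntegralHom x.left := IsIntegralHom.of_comp x.left X.hom
  have hpt : IsClosed {pt} := by
    have := x.left.isClosedMap.isClosed_range
    rwa [range_specOver_hom] at this
  obtain ⟨⟨p, φ⟩, hp⟩ := (Scheme.SpecToEquivOfField L X.left).symm.surjective x.left
  change Spec.map φ ≫ X.left.fromSpecResidueField p = x.left at hp
  obtain rfl : p = pt := by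
    simp only [pt]
    rw [← hp, Scheme.Hom.comp_apply, Scheme.fromSpecResidueField_apply]
  let g := Spec.preimage (X.left.fromSpecResidueField pt ≫ X.hom)
  have hg : Spec.map g = X.left.fromSpecResidueField pt ≫ X.hom := Spec.map_preimage _
  have hfin : IsFinite (Spec.map g) := by
    rw [hg]
    rw [isClosed_singleton_iff_isClosedImmersion] at hpt
    rw [isFinite_iff_locallyOfFiniteType_of_jacobsonSpace]
    infer_instance
  let κ : Type u := X.left.residueField pt
  let : Algebra K κ := g.hom.toAlgebra
  have hfd : FiniteDimensional K κ := (IsFinite.SpecMap_iff g).mp hfin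
  have hφ : g ≫ φ = CommRingCat.ofHom (algebraMap K L) := by
    apply Spec.map_injective
    rw [Spec.map_comp, hg, reassoc_of% hp]
    exact Over.w x
  let ψ : κ →ₐ[K] L :=
    { φ.hom with commutes' := fun r ↦ congr_arg (fun f ↦ f.hom r) hφ }
  let y : specOver K κ ⟶ X := Over.homMk (X.left.fromSpecResidueField pt) hg.symm
  have hy : Mono ((Over.forget _).map y) :=
    inferInstanceAs (Mono (X.left.fromSpecResidueField pt))
  exact ⟨κ, inferInstance, inferInstance, hfd, ψ, y, (Over.forget _).mono_of_mono_map hy, by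
    ext1; exact hp.symm⟩

lemma Points.exists_mono_factorization [Algebra.IsAlgebraic K L] (t : A.Points L) :
    ∃ (κ : Type u) (_ : Field κ) (_ : Algebra K κ) (_ : FiniteDimensional K κ) (ψ : κ →ₐ[K] L)
      (y : A.Points κ), Mono y.toHom ∧ t = Points.map A ψ y :=
  have := A.isProper
  AbVar.exists_mono_factorization A.toGroupScheme.X t.toHom

/-- Galois descent for points: a point fixed by a group of automorphisms is defined over the fixed
field. -/
lemma Points.mem_range_map_of_fixed [Algebra.IsAlgebraic K L] (H : Subgroup (L ≃ₐ[K] L))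
    (t : A.Points L) (ht : ∀ σ ∈ H, Points.map A (σ : L →ₐ[K] L) t = t) :
    t ∈ (Points.map A (IntermediateField.fixedField H).val).range := by
  obtain ⟨κ, _, _, _, ψ, y, hy, rfl⟩ := Points.exists_mono_factorization t
  -- As `y` is a monomorphism, fixing the point means fixing the embedding of `κ`, whose image then
  -- lies in the fixed field.
  have hfix (σ) (hσ : σ ∈ H) : (σ : L →ₐ[K] L).comp ψ = ψ := by
    have h := ht σ hσ
    rw [Points.map_map] at h
    exact specOverMap_injective ((cancel_mono y.toHom).mp h)
  let ψ' : κ →ₐ[K] IntermediateField.fixedField H :=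
    ψ.codRestrict (IntermediateField.fixedField H).toSubalgebra fun a σ ↦
      congr($(hfix σ.1 σ.2) a)
  exact ⟨Points.map A ψ' y, by rw [Points.map_map]; rfl⟩

/-- The point comes from a finite extension `κ`, which has finitely many `K`-embeddings into `L`. -/
lemma Points.finite_orbit [Algebra.IsAlgebraic K L] (t : A.Points L) :
    (Set.range fun σ : L ≃ₐ[K] L ↦ Points.map A (σ : L →ₐ[K] L) t).Finite := by
  obtain ⟨κ, _, _, _, ψ, y, -, rfl⟩ := Points.exists_mono_factorization t
  refine (Set.finite_range fun φ : κ →ₐ[K] L ↦ Points.map A φ y).subset ?_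
  rintro - ⟨σ, rfl⟩
  exact ⟨(σ : L →ₐ[K] L).comp ψ, (Points.map_map A _ _ _).symm⟩

end Points

/-! ### Torsion displacements, rank and fixed fields. -/

lemma exists_nsmul_eq_zero_of_finite {Γ : Type*} [AddCommGroup Γ] {s : Set Γ} (hs : s.Finite)
    (h : ∀ x ∈ s, IsOfFinAddOrder x) : ∃ n : ℕ, 0 < n ∧ ∀ x ∈ s, n • x = 0 := by
  refine ⟨∏ x ∈ hs.toFinset, addOrderOf x, Finset.prod_pos fun x hx ↦
    (h x (hs.mem_toFinset.mp hx)).addOrderOf_pos, fun x hx ↦ ?_⟩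
  rw [← addOrderOf_dvd_iff_nsmul_eq_zero]
  exact Finset.dvd_prod_of_mem _ (hs.mem_toFinset.mpr hx)

/-- If all `t - σ t` with `σ ∈ H` are torsion, then a multiple of `t` is defined over the fixed
field of `H`. -/
lemma Points.exists_nsmul_mem_range {K L : Type u} [Field K] [Field L] [Algebra K L]
    [Algebra.IsAlgebraic K L] (A : AbelianVariety K) (H : Subgroup (L ≃ₐ[K] L)) (t : A.Points L)
    (ht : ∀ σ ∈ H, IsOfFinAddOrder (t - Points.map A (σ : L →ₐ[K] L) t)) :
    ∃ n : ℕ, 0 < n ∧ n • t ∈ (Points.map A (IntermediateField.fixedField H).val).range := by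
  have hfin : ((fun σ : L ≃ₐ[K] L ↦ t - Points.map A (σ : L →ₐ[K] L) t) '' H).Finite :=
    ((Points.finite_orbit t).image (t - ·)).subset (by rintro - ⟨σ, -, rfl⟩; exact ⟨_, ⟨σ, rfl⟩, rfl⟩)
  obtain ⟨n, hn, h⟩ := exists_nsmul_eq_zero_of_finite hfin (by rintro - ⟨σ, hσ, rfl⟩; exact ht σ hσ)
  -- The single `n` kills every `t - σ t`, so `n • t` is fixed by `H`.
  refine ⟨n, hn, Points.mem_range_map_of_fixed H _ fun σ hσ ↦ ?_⟩
  have := h _ ⟨σ, hσ, rfl⟩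
  rw [nsmul_sub, sub_eq_zero] at this
  rw [map_nsmul, this]

/-- Tensoring with `ℚ` kills torsion: `q ⊗ x = (q / n) ⊗ (n • x)`. -/
lemma rationalRank_eq_zero {Γ : Type u} [AddCommGroup Γ]
    (h : ∀ x : Γ, ∃ n : ℕ, 0 < n ∧ n • x = 0) : rationalRank Γ = 0 := by
  have : Subsingleton (TensorProduct ℤ ℚ Γ) := by
    refine subsingleton_of_forall_eq 0 fun z ↦ ?_
    induction z with
    | zero => rfl
    | add a b ha hb => rw [ha, hb, add_zero]
    | tmul q x =>
      obtain ⟨n, hn, hx⟩ := h x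
      have hq : q = (n : ℤ) • (q / n) := by
        have : (n : ℚ) ≠ 0 := by positivity
        simp only [zsmul_eq_mul, Int.cast_natCast]
        field_simp
      rw [hq, TensorProduct.smul_tmul, natCast_zsmul, hx, TensorProduct.tmul_zero]
  exact rank_subsingleton' ℚ _

/-- The fixed field of a finite index subgroup of the Galois group is a finite extension. -/
lemma finiteDimensional_fixedField {K L : Type*} [Field K] [Field L] [Algebra K L] [IsGalois K L]
    (H : Subgroup (L ≃ₐ[K] L)) [H.FiniteIndex] :
    FiniteDimensional K (IntermediateField.fixedField H) := by
  rw [← InfiniteGalois.isOpen_iff_finite]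
  -- This subgroup contains `H` and is closed; closed of finite index means open.
  have : (IntermediateField.fixedField H).fixingSubgroup.FiniteIndex :=
    Subgroup.finiteIndex_of_le ((IntermediateField.le_iff_le _ _).mp le_rfl)
  exact Subgroup.isOpen_of_isClosed_of_finiteIndex _ (InfiniteGalois.fixingSubgroup_isClosed _)

/-! ### Neumann's covering lemma applied to displacements. -/

open scoped Pointwise

/-- If finitely many translates of subgroups cover the image of a homomorphism, then a multiple of
the image lies in one of the subgroups. -/
lemma exists_nsmul_mem_of_forall_mem_add_iUnion {Γ Δ J : Type*} [AddCommGroup Γ] [AddCommGroup Δ]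
    [Finite J] (f : Γ →+ Δ) {S : Set Δ} (hS : S.Finite) (H : J → AddSubgroup Δ)
    (h : ∀ x, f x ∈ S + ⋃ j, (H j : Set Δ)) : ∃ j, ∃ n : ℕ, 0 < n ∧ ∀ x, n • f x ∈ H j := by
  classical
  have := Fintype.ofFinite J
  -- Translates by elements of `S` are recentred at elements of the image of `f`, so that they pull
  -- back to cosets in `Γ`; an empty preimage gets the harmless value `0`.
  have hg (p : Δ × J) : ∃ g : Γ, ∀ x, f x - p.1 ∈ H p.2 → f x - f g ∈ H p.2 := by
    by_cases hp : ∃ x, f x - p.1 ∈ H p.2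
    · obtain ⟨g, hg⟩ := hp
      exact ⟨g, fun x hx ↦ by simpa using sub_mem hx hg⟩
    · exact ⟨0, fun x hx ↦ (hp ⟨x, hx⟩).elim⟩
  choose g hg using hg
  have hcov : ⋃ p ∈ hS.toFinset ×ˢ (Finset.univ : Finset J),
      g p +ᵥ (((H p.2).comap f : AddSubgroup Γ) : Set Γ) = Set.univ := by
    refine Set.eq_univ_of_forall fun x ↦ ?_
    obtain ⟨s, hs, b, hb, hx⟩ := Set.mem_add.mp (h x)
    obtain ⟨j, hj⟩ := Set.mem_iUnion.mp hb
    refine Set.mem_iUnion₂.mpr ⟨(s, j), by simpa using hs, ?_⟩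
    rw [Set.mem_vadd_set_iff_neg_vadd_mem]
    have := hg (s, j) x (by rw [← hx]; simpa using hj)
    simpa [sub_eq_neg_add] using this
  obtain ⟨p, -, hp⟩ := AddSubgroup.exists_finiteIndex_of_leftCoset_cover hcov
  refine ⟨p.2, ((H p.2).comap f).index, Nat.pos_of_ne_zero hp.index_ne_zero, fun x ↦ ?_⟩
  rw [← map_nsmul]
  exact ((H p.2).comap f).nsmul_index_mem x

/-- The elements `σ` of a commutative group of operators such that a multiple of `1 - σ` maps
into `H`. -/
def displacementSubgroup (G : Type*) {Γ : Type*} [Group G] [IsMulCommutative G] [AddCommGroup Γ]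
    [DistribMulAction G Γ] (H : AddSubgroup Γ) : Subgroup G where
  carrier := {σ | ∃ n : ℕ, 0 < n ∧ ∀ t : Γ, n • (t - σ • t) ∈ H}
  one_mem' := ⟨1, one_pos, fun t ↦ by simp⟩
  mul_mem' := by
    rintro σ τ ⟨m, hm, hσ⟩ ⟨n, hn, hτ⟩
    refine ⟨m * n, Nat.mul_pos hm hn, fun t ↦ ?_⟩
    -- Telescoping: the second term is the displacement of `σ • t` under `τ`, covered since `hτ`
    -- holds for all points.
    have : t - (σ * τ) • t = (t - σ • t) + (σ • t - τ • σ • t) := by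
      rw [mul_comm' σ τ, mul_smul]; abel
    rw [this, nsmul_add, mul_comm, mul_nsmul', mul_comm, mul_nsmul']
    exact add_mem (H.nsmul_mem (hσ t) n) (H.nsmul_mem (hτ _) m)
  inv_mem' := by
    rintro σ ⟨n, hn, hσ⟩
    refine ⟨n, hn, fun t ↦ ?_⟩
    have := neg_mem (hσ (σ⁻¹ • t))
    rwa [smul_inv_smul, ← smul_neg, neg_sub] at this

/-- The Galois action on points. -/
noncomputable instance {K L : Type u} [Field K] [Field L] [Algebra K L] (A : AbelianVariety K) :
    DistribMulAction (L ≃ₐ[K] L) (A.Points L) where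
  smul σ t := Points.map A (σ : L →ₐ[K] L) t
  one_smul t := by
    change Points.ofHom (specOverMap (AlgHom.id K L) ≫ t.toHom) = t
    have : specOverMap (AlgHom.id K L) = 𝟙 (specOver K L) := by
      ext1
      exact Spec.map_id _
    rw [this, Category.id_comp]
    rfl
  mul_smul σ τ t := (Points.map_map A (τ : L →ₐ[K] L) (σ : L →ₐ[K] L) t).symm
  smul_zero σ := map_zero (Points.map A (σ : L →ₐ[K] L))
  smul_add σ := map_add (Points.map A (σ : L →ₐ[K] L))

/-- Neumann's lemma is used twice: on points, for each `σ` separately, and then on `G`, which the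
resulting subgroups cover. -/
lemma exists_finiteIndex_displacementSubgroup {G Γ Δ J : Type*} [Group G] [IsMulCommutative G]
    [AddCommGroup Γ] [DistribMulAction G Γ] [AddCommGroup Δ] [Finite J] (f : Γ →+ Δ) {S : Set Δ}
    (hS : S.Finite) (H : J → AddSubgroup Δ)
    (h : ∀ (t : Γ) (σ : G), f (t - σ • t) ∈ S + ⋃ j, (H j : Set Δ)) :
    ∃ j, (displacementSubgroup G ((H j).comap f)).FiniteIndex := by
  have := Fintype.ofFinite J
  have hcov : ⋃ j ∈ (Finset.univ : Finset J),
      (1 : G) • (displacementSubgroup G ((H j).comap f) : Set G) = Set.univ := by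
    refine Set.eq_univ_of_forall fun σ ↦ ?_
    obtain ⟨j, n, hn, hj⟩ := exists_nsmul_mem_of_forall_mem_add_iUnion
      (f.comp (AddMonoidHom.id Γ - DistribSMul.toAddMonoidHom Γ σ)) hS H fun t ↦ h t σ
    refine Set.mem_iUnion₂.mpr ⟨j, Finset.mem_univ j, ?_⟩
    rw [one_smul]
    refine ⟨n, hn, fun t ↦ ?_⟩
    rw [AddSubgroup.mem_comap, map_nsmul]
    exact hj t
  obtain ⟨j, -, hj⟩ := Subgroup.exists_finiteIndex_of_leftCoset_cover hcov
  exact ⟨j, hj⟩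

end AbVar

/-! ### The main theorem. -/

open scoped Pointwise
theorem mainTheorem6 {K L Kbar : Type u} [Field K] [CharZero K] [Field L] [Field Kbar]
    [Algebra K L] [Algebra K Kbar] [Algebra L Kbar] [IsScalarTower K L Kbar]
    [IsAlgClosure K Kbar] [IsAbelianGalois K L]
    (A : AbVar.AbelianVariety K) {k : ℕ} (A' : Fin k → AbVar.AbelianVariety K)
    (hsimple : ∀ i, (A' i).IsSimple)
    (α : (∏ᶜ fun i => (A' i).toGroupScheme) ⟶ A.toGroupScheme)
    (hα : AbVar.IsIsogeny α)
    (hrank : ∀ (i : Fin k) (K₁ : IntermediateField K L) [FiniteDimensional K K₁],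
      Cardinal.aleph0 ≤ AbVar.rationalRank
        ((A' i).Points L ⧸ (AbVar.AbelianVariety.Points.map (A' i) K₁.val).range))
    (S : Set (A.Points Kbar)) (hS : S.Finite)
    {r : ℕ} (B : Fin r → A.Subvariety) (hB : ∀ j, (B j).IsProperSub) :
    ∃ (t : A.Points L) (σ : L ≃ₐ[K] L),
      AbVar.AbelianVariety.Points.map A (IsScalarTower.toAlgHom K L Kbar)
          (t - AbVar.AbelianVariety.Points.map A (σ : L →ₐ[K] L) t) ∉
        S + ⋃ j, (B j).points Kbar := by
  by_contra! hcon
  obtain ⟨j, hG⟩ := AbVar.exists_finiteIndex_displacementSubgroup (G := L ≃ₐ[K] L)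
    (AbVar.AbelianVariety.Points.map A (IsScalarTower.toAlgHom K L Kbar)) hS
    (fun j ↦ AbVar.Subvariety.pointsSubgroup (B j) Kbar) hcon
  obtain ⟨i, hi⟩ := AbVar.exists_comap_ne_univ A' α hα.surjective (B j) (hB j)
  generalize hGj : AbVar.displacementSubgroup (L ≃ₐ[K] L) (Γ := A.Points L) _ = G at hG
  have := AbVar.finiteDimensional_fixedField G
  refine (hrank i (IntermediateField.fixedField G)).not_gt ?_
  rw [AbVar.rationalRank_eq_zero]
  · exact Cardinal.aleph0_pos
  intro x
  obtain ⟨t, rfl⟩ := QuotientAddGroup.mk_surjective x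
  have htor : ∀ σ ∈ G, IsOfFinAddOrder
      (t - AbVar.AbelianVariety.Points.map (A' i) (σ : L →ₐ[K] L) t) := by
    intro σ hσ
    rw [← hGj] at hσ
    obtain ⟨n, hn, h⟩ := hσ
    let f := AbVar.factorInclusion A' i ≫ α
    let φ := IsScalarTower.toAlgHom K L Kbar
    have hmem := h (AbVar.Points.push f L t)
    have hσt : σ • AbVar.Points.push f L t =
        AbVar.Points.push f L (AbVar.AbelianVariety.Points.map (A' i) (σ : L →ₐ[K] L) t) :=
      AbVar.Points.map_push f (σ : L →ₐ[K] L) t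
    rw [hσt, ← map_sub, ← map_nsmul, AddSubgroup.mem_comap, AbVar.Points.map_push] at hmem
    have hfin := AbVar.isOfFinAddOrder_of_push_mem (hsimple i) (B j) f hi _ hmem
    -- Torsion is detected over `Kbar`, pulled back to `L` by injectivity, and freed of the
    -- multiplier `n`.
    exact ((AbVar.Points.map_injective (A' i) φ).isOfFinAddOrder_iff.mp hfin).of_nsmul hn.ne'
  obtain ⟨n, hn, h⟩ := AbVar.Points.exists_nsmul_mem_range (A' i) G t htor
  exact ⟨n, hn, (QuotientAddGroup.eq_zero_iff _).mpr h⟩
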